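/- Let $n,k$ be natural numbers with $k\le n-1$, let $U=\{1,\dots,n\}$ be a set of users, let $U^H\subseteq U$ be the set of honest users (the other users are malicious), $n_H=|U^H|$ and $\rho=n_H/n$. Let $\varepsilon,\delta\in(0,1)$ and $\sigma_\eta,\sigma_\Delta>0$. GOPA on a random $k$-out graph is the following process, for private values $X=(X_u)_{u\in U}\in[0,1]^n$. Each honest user selects, independently of the other honest users, a uniformly random set of $k$ users other than itself. The malicious users select arbitrary sets of users, possibly at random and depending on the selections of the honest users. The graph $G=(U,E)$ has the edge $\{u,v\}$, $u\ne v$, iff $u$ selected $v$ or $v$ selected $u$. Then, independently of $G$, draw independent $\Delta_{u,v}\sim\mathcal N(0,\sigma_\Delta^2)$ for $\{u,v\}\in E$ with $u<v$, put $\Delta_{v,u}=-\Delta_{u,v}$, and draw independent $\eta_u\sim\mathcal N(0,\sigma_\eta^2)$ for $u\in U$; each user $u$ publishes $\hat X_u=X_u+\sum_{v:\{u,v\}\in E}\Delta_{u,v}+\eta_u$. The output is the view of the adversary: the graph $G$, all noisy values $\hat X_u$, the values $X_u$ and $\eta_u$ of the malicious users, and all $\Delta_{u,v}$ for which $u$ or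 $v$ is malicious. Suppose that $$\rho n\ge 81,\quad \rho k\ge 4\log\frac{2\rho n}{3\delta},\quad \rho k\ge 6\log\frac{\rho n}{3},\quad \rho k\ge \frac32+\frac94\log\frac{2e}{\delta},$$ and put $$\theta=\frac{1}{n_H\sigma_\eta^2}+\Big(\frac{1}{\lfloor (k-1)\rho/3\rfloor-1}+\frac{12+6\log n_H}{n_H}\Big)\frac1{\sigma_\Delta^2}.$$ If $$\varepsilon\ge \frac{\theta}{2}+\theta^{1/2}\qquad\text{and}\qquad \Big(\varepsilon-\frac{\theta}{2}\Big)^2\ge 2\log\Big(\frac{2}{\delta\sqrt{2\pi}}\Big)\,\theta,$$ then this process is $(\varepsilon,3\delta)$-differentially private: for all $X,X'\in[0,1]^n$ that differ only in the value of one honest user, and every measurable set $\mathcal O$ of outputs, $$\Pr[\text{output on }X\in\mathcal O]\le e^{\varepsilon}\,\Pr[\text{output on }X'\in\mathcal O]+3\delta .$$ -/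

import Mathlib

open MeasureTheory ProbabilityTheory
open scoped NNReal ENNReal

namespace Gopa

/-- `(ε, δ)`-differential privacy of a randomized mechanism `M`, given by the law `M X` of its
output on the dataset `X`, with respect to a relation `nbr` of neighbouring datasets. -/
def IsDP {D Ω : Type*} [MeasurableSpace Ω] (nbr : D → D → Prop) (M : D → Measure Ω)
    (ε δ : ℝ) : Prop :=
  ∀ X X' : D, nbr X X' → ∀ O : Set Ω, MeasurableSet O →
    M X O ≤ ENNReal.ofReal (Real.exp ε) * M X' O + ENNReal.ofReal δ

/-- The private values of the `n` users, each in `[0, 1]`. -/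
abbrev Dataset (n : ℕ) : Type := Fin n → Set.Icc (0 : ℝ) 1

/-- Two datasets that differ at most in the value of one honest user. -/
def HonestNeighbors {n : ℕ} (H : Finset (Fin n)) (X X' : Dataset n) : Prop :=
  ∃ v ∈ H, ∀ u, u ≠ v → X u = X' u

/-! ### The communication graph -/

/-- The possible joint selections of the honest users: each of them selects `k` other users. -/
def honestSelections {n : ℕ} (H : Finset (Fin n)) (k : ℕ) :
    Finset ({u // u ∈ H} → Finset (Fin n)) :=
  Fintype.piFinset fun u => (Finset.univ.erase u.1).powersetCard k

theorem honestSelections_nonempty {n : ℕ} (H : Finset (Fin n)) {k : ℕ} (hk : k < n) :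
    (honestSelections H k).Nonempty := by
  refine Fintype.piFinset_nonempty.2 fun u => Finset.powersetCard_nonempty.2 ?_
  rw [Finset.card_erase_of_mem (Finset.mem_univ _), Finset.card_univ, Fintype.card_fin]
  omega

/-- A selection strategy of the malicious users: given the selections of the honest users, an
arbitrary law for the sets of users that the malicious users select. -/
abbrev Strategy {n : ℕ} (H : Finset (Fin n)) : Type :=
  ({u // u ∈ H} → Finset (Fin n)) → PMF ({u // u ∉ H} → Finset (Fin n))

/-- The law of the selections of all users. The honest users select independently and uniformly
(equivalently, their joint selection is uniform on the product set `honestSelections H k`), the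
malicious users follow the strategy `adv`. -/
noncomputable def selectionLaw {n : ℕ} (H : Finset (Fin n)) (k : ℕ) (hk : k < n)
    (adv : Strategy H) : PMF (Fin n → Finset (Fin n)) :=
  (PMF.uniformOfFinset (honestSelections H k) (honestSelections_nonempty H hk)).bind fun c =>
    (adv c).map fun d u => if h : u ∈ H then c ⟨u, h⟩ else d ⟨u, h⟩

/-- The communication graph: distinct users `u`, `v` are adjacent iff `u` selected `v` or `v`
selected `u` (or both). -/
def graphOf {n : ℕ} (c : Fin n → Finset (Fin n)) : SimpleGraph (Fin n) :=
  SimpleGraph.fromRel fun u v => v ∈ c u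

/-! ### The protocol -/

open Classical in
/-- The pairwise noise term `Δ_{u,v}`. For an edge `{u, v}` with `u < v` the user `u` adds the
number `x s(u, v)` and the user `v` subtracts it; the numbers attached to non-edges are not used. -/
noncomputable def pairNoise {n : ℕ} (G : SimpleGraph (Fin n)) (x : Sym2 (Fin n) → ℝ)
    (u v : Fin n) : ℝ :=
  if G.Adj u v then (if u < v then x s(u, v) else -x s(u, v)) else 0

/-- The noisy value `X_u + ∑_{v ∈ N(u)} Δ_{u,v} + η_u` that user `u` reveals. -/
noncomputable def noisyValue {n : ℕ} (G : SimpleGraph (Fin n)) (X : Dataset n) (η : Fin n → ℝ)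
    (x : Sym2 (Fin n) → ℝ) (u : Fin n) : ℝ :=
  (X u : ℝ) + ∑ v, pairNoise G x u v + η u

/-- What the adversary observes, in this order: the graph, the noisy values of all users, the
private values of the malicious users, the independent noise of the malicious users, and the
pairwise noise terms in which a malicious user takes part. -/
abbrev View {n : ℕ} (H : Finset (Fin n)) : Type :=
  SimpleGraph (Fin n) × (Fin n → ℝ) × ({u // u ∉ H} → ℝ) × ({u // u ∉ H} → ℝ) ×
    ({u // u ∉ H} → Fin n → ℝ)

/-- The view of the adversary as a function of the graph, the private values and the noise. -/
noncomputable def view {n : ℕ} (H : Finset (Fin n)) (G : SimpleGraph (Fin n)) (X : Dataset n)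
    (η : Fin n → ℝ) (x : Sym2 (Fin n) → ℝ) : View H :=
  (G, noisyValue G X η x, fun u => (X u.1 : ℝ), fun u => η u.1, fun u v => pairNoise G x u.1 v)

/-- The law of the adversary's view of the protocol run on a fixed graph: all noise variables are
independent centred Gaussians, the `η_u` of variance `ση ^ 2`, the pairwise ones of variance
`σΔ ^ 2`. -/
noncomputable def gopaOn {n : ℕ} (H : Finset (Fin n)) (ση σΔ : ℝ≥0) (G : SimpleGraph (Fin n))
    (X : Dataset n) : Measure (View H) :=
  ((Measure.pi fun _ : Fin n => gaussianReal 0 (ση ^ 2)).prod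
    (Measure.pi fun _ : Sym2 (Fin n) => gaussianReal 0 (σΔ ^ 2))).map
      fun ω => view H G X ω.1 ω.2

/-- The law of the adversary's view of the whole process: generation of the random `k`-out graph,
followed by the protocol on that graph. -/
noncomputable def gopaKOut {n : ℕ} (H : Finset (Fin n)) (k : ℕ) (hk : k < n) (adv : Strategy H)
    (ση σΔ : ℝ≥0) (X : Dataset n) : Measure (View H) :=
  Measure.sum fun c : Fin n → Finset (Fin n) =>
    selectionLaw H k hk adv c • gopaOn H ση σΔ (graphOf c) X

end Gopa

namespace Gopa

/-!
Fix a graph and two datasets that differ only at the honest user `v`. Let a flow between honest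
users spread one unit from `v` evenly over all of them; shifting the pairwise noise along the flow
and the independent noise by `1 / n_H` turns the view of one dataset into that of the other. The two
views are therefore images of Gaussians whose means differ by a vector of squared normalized length
`θ = 1 / (n_H σ_η²) + R / σ_Δ²`, `R` the energy of the flow, and a Chernoff bound on the Gaussian
privacy loss gives the `(ε, δ)` guarantee.

The least energy of a flow is dual to the Dirichlet energy of potentials: it is at most `R` as soon
as `(f v - mean f)² ≤ R · (energy of f)` for every potential `f`. On an expanding graph this is
proved by descending through the quantile levels of `f`: the edges across consecutive levels carry
enough energy to control the gaps between them, and the neighbours of `v` pay for the first step.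

The random selections expand, and give `v` enough honest neighbours, outside an event of
probability at most `1.2 δ`: a union bound over the pairs of sets violating expansion and a
Chernoff bound for the degree of `v`.
-/

/-! ### Shifts of Gaussian product measures -/

theorem lintegral_pi_prod {ι : Type*} [Fintype ι] {α : ι → Type*} [∀ i, MeasurableSpace (α i)]
    (μ : ∀ i, Measure (α i)) [∀ i, IsProbabilityMeasure (μ i)] {f : ∀ i, α i → ℝ≥0∞}
    (hf : ∀ i, Measurable (f i)) :
    ∫⁻ x, ∏ i, f i (x i) ∂(Measure.pi μ) = ∏ i, ∫⁻ y, f i y ∂(μ i) := by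
  rw [lintegral_prod_eq_prod_lintegral_of_indepFun (μ := Measure.pi μ) Finset.univ
    (fun i x => f i (x i)) (iIndepFun_pi fun i => (hf i).aemeasurable)
    fun i => (hf i).comp (measurable_pi_apply i)]
  exact Finset.prod_congr rfl fun i _ => (measurePreserving_eval μ i).lintegral_comp (hf i)

theorem pi_withDensity {ι : Type*} [Fintype ι] {α : ι → Type*} [∀ i, MeasurableSpace (α i)]
    (μ : ∀ i, Measure (α i)) [∀ i, IsProbabilityMeasure (μ i)] {f : ∀ i, α i → ℝ≥0∞}
    (hf : ∀ i, Measurable (f i)) [∀ i, SigmaFinite ((μ i).withDensity (f i))] :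
    Measure.pi (fun i => (μ i).withDensity (f i)) =
      (Measure.pi μ).withDensity fun x => ∏ i, f i (x i) := by
  refine Measure.pi_eq fun s hs => ?_
  have indicator_prod : ∀ x, (Set.univ.pi s).indicator (fun x => ∏ i, f i (x i)) x =
      ∏ i, (s i).indicator (f i) (x i) := by
    intro x
    by_cases hx : x ∈ Set.univ.pi s
    · rw [Set.indicator_of_mem hx]
      exact Finset.prod_congr rfl fun i _ => (Set.indicator_of_mem (hx i trivial) _).symm
    · rw [Set.indicator_of_notMem hx]
      obtain ⟨i, hi⟩ : ∃ i, x i ∉ s i := by simpa using hx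
      exact (Finset.prod_eq_zero (Finset.mem_univ i) (Set.indicator_of_notMem hi _)).symm
  rw [withDensity_apply _ (MeasurableSet.univ_pi hs),
    ← lintegral_indicator (MeasurableSet.univ_pi hs)]
  simp_rw [indicator_prod]
  rw [lintegral_pi_prod _ fun i => (hf i).indicator (hs i)]
  refine Finset.prod_congr rfl fun i _ => ?_
  rw [lintegral_indicator (hs i), withDensity_apply _ (hs i)]

theorem withDensity_apply_le_mul_add {Ω : Type*} [MeasurableSpace Ω] (μ : Measure Ω)
    {f : Ω → ℝ≥0∞} (hf : Measurable f) (a : ℝ≥0∞) {s : Set Ω} (hs : MeasurableSet s) :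
    μ.withDensity f s ≤ a * μ s + μ.withDensity f {x | a ≤ f x} := by
  have hge : MeasurableSet {x | a ≤ f x} := measurableSet_le measurable_const hf
  have hsplit : s ⊆ (s \ {x | a ≤ f x}) ∪ {x | a ≤ f x} := fun x hx => by
    by_cases h : a ≤ f x
    exacts [Or.inr h, Or.inl ⟨hx, h⟩]
  refine ((measure_mono hsplit).trans (measure_union_le _ _)).trans (add_le_add_left ?_ _)
  calc μ.withDensity f (s \ {x | a ≤ f x}) = ∫⁻ x in s \ {x | a ≤ f x}, f x ∂μ :=
        withDensity_apply _ (hs.diff hge)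
    _ ≤ ∫⁻ _ in s \ {x | a ≤ f x}, a ∂μ :=
        setLIntegral_mono measurable_const fun x hx => (not_le.1 hx.2).le
    _ = a * μ (s \ {x | a ≤ f x}) := setLIntegral_const _ _
    _ ≤ a * μ s := by gcongr; exact Set.sdiff_subset

theorem gaussianReal_withDensity_exp {v : ℝ≥0} (hv : v ≠ 0) (t : ℝ) :
    (gaussianReal 0 v).withDensity (fun x => ENNReal.ofReal (Real.exp ((t * x - t ^ 2 / 2) / v))) =
      gaussianReal t v := by
  have hv' : (v : ℝ) ≠ 0 := by exact_mod_cast hv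
  rw [gaussianReal_of_var_ne_zero _ hv, gaussianReal_of_var_ne_zero _ hv,
    ← withDensity_mul _ (measurable_gaussianPDF 0 v) (by fun_prop)]
  congr 1
  ext x
  rw [Pi.mul_apply, gaussianPDF, gaussianPDF, ← ENNReal.ofReal_mul (gaussianPDFReal_nonneg _ _ _),
    gaussianPDFReal, gaussianPDFReal, mul_assoc, ← Real.exp_add]
  congr 3
  field_simp
  ring

section PrivacyLoss

variable {ι : Type*} [Fintype ι] {v : ι → ℝ≥0}

/-- The privacy loss of a shift by `t`: the logarithm of the density of the product of the
`𝒩(t i, v i)` with respect to the product of the `𝒩(0, v i)`. -/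
noncomputable def privacyLoss (v : ι → ℝ≥0) (t x : ι → ℝ) : ℝ :=
  ∑ i, (t i * x i - t i ^ 2 / 2) / v i

theorem measurable_privacyLoss (t : ι → ℝ) : Measurable (privacyLoss v t) :=
  Finset.measurable_sum _ fun i _ => by fun_prop

theorem gaussianPi_map_add (v : ι → ℝ≥0) (t : ι → ℝ) :
    (Measure.pi fun i => gaussianReal 0 (v i)).map (fun x => x + t) =
      Measure.pi fun i => gaussianReal (t i) (v i) := by
  have h := Measure.pi_map_pi (μ := fun i => gaussianReal 0 (v i)) (f := fun i x => x + t i)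
    fun i => by fun_prop
  simp only [gaussianReal_map_add_const, zero_add] at h
  exact h

theorem gaussianPi_withDensity_exp_privacyLoss (hv : ∀ i, v i ≠ 0) (t : ι → ℝ) :
    (Measure.pi fun i => gaussianReal 0 (v i)).withDensity
        (fun x => ENNReal.ofReal (Real.exp (privacyLoss v t x))) =
      Measure.pi fun i => gaussianReal (t i) (v i) := by
  have : ∀ i, SigmaFinite ((gaussianReal 0 (v i)).withDensity
      fun x => ENNReal.ofReal (Real.exp ((t i * x - t i ^ 2 / 2) / v i))) := fun i => by
    rw [gaussianReal_withDensity_exp (hv i)]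
    infer_instance
  have hpi := pi_withDensity (fun i => gaussianReal 0 (v i))
    (f := fun i x => ENNReal.ofReal (Real.exp ((t i * x - t i ^ 2 / 2) / v i))) fun i => by fun_prop
  simp_rw [gaussianReal_withDensity_exp (hv _)] at hpi
  simp_rw [hpi, privacyLoss, Real.exp_sum,
    ENNReal.ofReal_prod_of_nonneg fun _ _ => (Real.exp_pos _).le]

theorem exp_mul_loss_eq (v : ℝ≥0) (t l x : ℝ) :
    Real.exp (l * ((t * x - t ^ 2 / 2) / v)) =
      Real.exp (-(l * t ^ 2 / 2 / v)) * Real.exp ((l * t / v) * x) := by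
  rw [← Real.exp_add]
  congr 1
  ring

theorem integrable_exp_mul_loss (v : ℝ≥0) (t l : ℝ) :
    Integrable (fun x => Real.exp (l * ((t * x - t ^ 2 / 2) / v))) (gaussianReal t v) := by
  simp_rw [exp_mul_loss_eq]
  exact (integrable_exp_mul_gaussianReal _).const_mul _

theorem integral_exp_mul_loss {v : ℝ≥0} (hv : v ≠ 0) (t l : ℝ) :
    ∫ x, Real.exp (l * ((t * x - t ^ 2 / 2) / v)) ∂(gaussianReal t v) =
      Real.exp ((l ^ 2 + l) / 2 * (t ^ 2 / v)) := by
  have hv' : (v : ℝ) ≠ 0 := by exact_mod_cast hv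
  have hmgf := congrFun (mgf_id_gaussianReal (μ := t) (v := v)) (l * t / v)
  simp only [mgf, id] at hmgf
  simp_rw [exp_mul_loss_eq]
  rw [integral_const_mul, hmgf, ← Real.exp_add]
  congr 1
  field_simp
  ring

theorem gaussianPi_privacyLoss_ge_le (hv : ∀ i, v i ≠ 0) (t : ι → ℝ) {l : ℝ} (hl : 0 ≤ l) (ε : ℝ) :
    (Measure.pi fun i => gaussianReal (t i) (v i)) {x | ε ≤ privacyLoss v t x} ≤
      ENNReal.ofReal (Real.exp (-(l * ε) + (l ^ 2 + l) / 2 * ∑ i, t i ^ 2 / v i)) := by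
  set μ := Measure.pi fun i => gaussianReal (t i) (v i)
  have hmgf : ∫ x, Real.exp (l * privacyLoss v t x) ∂μ =
      Real.exp ((l ^ 2 + l) / 2 * ∑ i, t i ^ 2 / v i) := by
    simp_rw [privacyLoss, Finset.mul_sum, Real.exp_sum]
    rw [integral_fintype_prod_eq_prod
      fun i x => Real.exp (l * ((t i * x - t i ^ 2 / 2) / v i))]
    exact Finset.prod_congr rfl fun i _ => integral_exp_mul_loss (hv i) _ _
  have hint : Integrable (fun x => Real.exp (l * privacyLoss v t x)) μ := by
    simp_rw [privacyLoss, Finset.mul_sum, Real.exp_sum]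
    exact Integrable.fintype_prod fun i => integrable_exp_mul_loss _ _ _
  rw [← ofReal_measureReal]
  refine ENNReal.ofReal_le_ofReal ((measure_ge_le_exp_mul_mgf ε hl hint).trans_eq ?_)
  rw [mgf, hmgf, ← Real.exp_add, neg_mul]

theorem gaussianPi_preimage_add_le (hv : ∀ i, v i ≠ 0) (t : ι → ℝ) {θ ε : ℝ} (hθ : 0 < θ)
    (ht : ∑ i, t i ^ 2 / v i ≤ θ) (hε : θ / 2 ≤ ε) {s : Set (ι → ℝ)} (hs : MeasurableSet s) :
    (Measure.pi fun i => gaussianReal 0 (v i)) ((fun x => x + t) ⁻¹' s) ≤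
      ENNReal.ofReal (Real.exp ε) * (Measure.pi fun i => gaussianReal 0 (v i)) s +
        ENNReal.ofReal (Real.exp (-((ε - θ / 2) ^ 2 / (2 * θ)))) := by
  set l : ℝ := (ε - θ / 2) / θ with hl_def
  have hl : 0 ≤ l := div_nonneg (by linarith) hθ.le
  have hexponent : -(l * ε) + (l ^ 2 + l) / 2 * ∑ i, t i ^ 2 / v i ≤
      -((ε - θ / 2) ^ 2 / (2 * θ)) :=
    calc _ ≤ -(l * ε) + (l ^ 2 + l) / 2 * θ := by gcongr
      _ = _ := by rw [hl_def]; field_simp; ring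
  have htail := gaussianPi_privacyLoss_ge_le hv t hl ε
  rw [← gaussianPi_withDensity_exp_privacyLoss hv t] at htail
  rw [← Measure.map_apply (by fun_prop) hs, gaussianPi_map_add,
    ← gaussianPi_withDensity_exp_privacyLoss hv t]
  refine (withDensity_apply_le_mul_add _
    (measurable_privacyLoss t).exp.ennreal_ofReal (ENNReal.ofReal (Real.exp ε)) hs).trans ?_
  simp_rw [ENNReal.ofReal_le_ofReal_iff (Real.exp_pos _).le, Real.exp_le_exp]
  gcongr
  exact htail.trans (ENNReal.ofReal_le_ofReal (Real.exp_le_exp.2 hexponent))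

end PrivacyLoss

/-! ### Privacy on a fixed graph -/

section FixedGraph

variable {n : ℕ} {H : Finset (Fin n)} {G : SimpleGraph (Fin n)} {v : Fin n}
  {y : Sym2 (Fin n) → ℝ} {X X' : Dataset n}

theorem pairNoise_add (G : SimpleGraph (Fin n)) (x y : Sym2 (Fin n) → ℝ) (u w : Fin n) :
    pairNoise G (x + y) u w = pairNoise G x u w + pairNoise G y u w := by
  unfold pairNoise
  split_ifs
  · rfl
  · exact neg_add _ _
  · exact (add_zero 0).symm

theorem pairNoise_smul (G : SimpleGraph (Fin n)) (a : ℝ) (x : Sym2 (Fin n) → ℝ) (u w : Fin n) :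
    pairNoise G (a • x) u w = a * pairNoise G x u w := by
  unfold pairNoise
  split_ifs <;> simp

theorem measurable_pairNoise (G : SimpleGraph (Fin n)) (u w : Fin n) :
    Measurable fun x => pairNoise G x u w := by
  unfold pairNoise
  split_ifs <;> fun_prop

theorem measurable_view (H : Finset (Fin n)) (G : SimpleGraph (Fin n)) (X : Dataset n) :
    Measurable fun ω : (Fin n → ℝ) × (Sym2 (Fin n) → ℝ) => view H G X ω.1 ω.2 := by
  have hpair : ∀ u w, Measurable fun ω : (Fin n → ℝ) × (Sym2 (Fin n) → ℝ) => pairNoise G ω.2 u w :=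
    fun u w => (measurable_pairNoise G u w).comp measurable_snd
  have hnoisy : ∀ u, Measurable fun ω : (Fin n → ℝ) × (Sym2 (Fin n) → ℝ) =>
      noisyValue G X ω.1 ω.2 u :=
    fun u => (measurable_const.add (Finset.measurable_sum _ fun w _ => hpair u w)).add (by fun_prop)
  exact measurable_const.prodMk ((measurable_pi_lambda _ hnoisy).prodMk
    (measurable_const.prodMk (Measurable.prodMk (by fun_prop)
      (measurable_pi_lambda _ fun u => measurable_pi_lambda _ fun w => hpair u.1 w))))

/-- A flow along the edges between honest users that carries a unit from `v` to the uniform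
distribution on the honest users. Like the pairwise noise, it is given by one number per edge,
counted from the smaller end to the larger one. -/
structure IsHonestFlow (H : Finset (Fin n)) (G : SimpleGraph (Fin n)) (v : Fin n)
    (y : Sym2 (Fin n) → ℝ) : Prop where
  eq_zero : ∀ u ∉ H, ∀ w, y s(u, w) = 0
  div_eq : ∀ u ∈ H, ∑ w, pairNoise G y u w = (if u = v then 1 else 0) - 1 / (H.card : ℝ)

theorem IsHonestFlow.pairNoise_eq_zero (hy : IsHonestFlow H G v y) {u : Fin n} (hu : u ∉ H)
    (w : Fin n) : pairNoise G y u w = 0 := by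
  simp [pairNoise, hy.eq_zero u hu w]

/-- The shift of the noise variables that hides a change by `a` of the private value of one honest
user: the flow `a • y` spreads the change over the honest users, and their independent noise
absorbs the shares `a / |H|`. -/
noncomputable def noiseShift (H : Finset (Fin n)) (a : ℝ) (y : Sym2 (Fin n) → ℝ) :
    Fin n ⊕ Sym2 (Fin n) → ℝ :=
  Sum.elim (fun u => if u ∈ H then a / H.card else 0) (a • y)

theorem view_eq_view_add_noiseShift (hv : v ∈ H) (hy : IsHonestFlow H G v y)
    (hX : ∀ u, u ≠ v → X u = X' u) (z : Fin n ⊕ Sym2 (Fin n) → ℝ) :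
    view H G X (z ∘ Sum.inl) (z ∘ Sum.inr) =
      view H G X' ((z + noiseShift H ((X v : ℝ) - X' v) y) ∘ Sum.inl)
        ((z + noiseShift H ((X v : ℝ) - X' v) y) ∘ Sum.inr) := by
  set a : ℝ := (X v : ℝ) - X' v with ha
  have hne : ∀ u ∉ H, u ≠ v := fun u hu h => hu (h ▸ hv)
  have hinl : (z + noiseShift H a y) ∘ Sum.inl =
      z ∘ Sum.inl + fun u => if u ∈ H then a / H.card else 0 := rfl
  have hinr : (z + noiseShift H a y) ∘ Sum.inr = z ∘ Sum.inr + a • y := rfl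
  rw [hinl, hinr]
  refine Prod.ext rfl (Prod.ext (funext fun u => ?_) (Prod.ext (funext fun u => ?_)
    (Prod.ext (funext fun u => ?_) (funext fun u => funext fun w => ?_))))
  · simp only [view, noisyValue, pairNoise_add, pairNoise_smul, Finset.sum_add_distrib,
      ← Finset.mul_sum, Pi.add_apply]
    by_cases hu : u ∈ H
    · rw [hy.div_eq u hu, if_pos hu]
      rcases eq_or_ne u v with rfl | huv
      · rw [if_pos rfl, ha]
        ring
      · rw [if_neg huv, hX u huv]
        ring
    · rw [if_neg hu, hX u (hne u hu), Finset.sum_eq_zero fun w _ => hy.pairNoise_eq_zero hu w]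
      ring
  · simp only [view, hX u.1 (hne u.1 u.2)]
  · simp [view, u.2]
  · simp [view, pairNoise_add, pairNoise_smul, hy.pairNoise_eq_zero u.2]

/-- The variances of all noise variables of the protocol. -/
def noiseVariance (n : ℕ) (ση σΔ : ℝ≥0) : Fin n ⊕ Sym2 (Fin n) → ℝ≥0 :=
  Sum.elim (fun _ => ση ^ 2) (fun _ => σΔ ^ 2)

theorem noiseVariance_ne_zero {ση σΔ : ℝ≥0} (hση : 0 < ση) (hσΔ : 0 < σΔ)
    (i : Fin n ⊕ Sym2 (Fin n)) : noiseVariance n ση σΔ i ≠ 0 := by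
  rcases i with _ | _
  · exact (pow_pos hση 2).ne'
  · exact (pow_pos hσΔ 2).ne'

theorem gopaOn_apply (H : Finset (Fin n)) (ση σΔ : ℝ≥0) (G : SimpleGraph (Fin n))
    (X : Dataset n) {O : Set (View H)} (hO : MeasurableSet O) :
    gopaOn H ση σΔ G X O = (Measure.pi fun i => gaussianReal 0 (noiseVariance n ση σΔ i))
      {z | view H G X (z ∘ Sum.inl) (z ∘ Sum.inr) ∈ O} := by
  rw [gopaOn, Measure.map_apply (measurable_view H G X) hO]
  exact ((measurePreserving_sumPiEquivProdPi (X := fun _ => ℝ)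
    fun i => gaussianReal 0 (noiseVariance n ση σΔ i)).measure_preimage
      (measurable_view H G X hO).nullMeasurableSet).symm

theorem measurableSet_view_mem (G : SimpleGraph (Fin n)) (X : Dataset n) {O : Set (View H)}
    (hO : MeasurableSet O) : MeasurableSet {z : Fin n ⊕ Sym2 (Fin n) → ℝ |
      view H G X (z ∘ Sum.inl) (z ∘ Sum.inr) ∈ O} := by
  have hsplit : Measurable fun z : Fin n ⊕ Sym2 (Fin n) → ℝ => (z ∘ Sum.inl, z ∘ Sum.inr) :=
    (measurable_pi_lambda _ fun _ => measurable_pi_apply _).prodMk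
      (measurable_pi_lambda _ fun _ => measurable_pi_apply _)
  exact ((measurable_view H G X).comp hsplit) hO

theorem sum_noiseShift_sq_div_le {a : ℝ} (ha : |a| ≤ 1) (H : Finset (Fin n)) (ση σΔ : ℝ≥0)
    (y : Sym2 (Fin n) → ℝ) :
    ∑ i, noiseShift H a y i ^ 2 / noiseVariance n ση σΔ i ≤
      1 / ((H.card : ℝ) * (ση : ℝ) ^ 2) + (∑ e, y e ^ 2) / (σΔ : ℝ) ^ 2 := by
  have ha2 : a ^ 2 ≤ 1 := (sq_le_one_iff_abs_le_one a).2 ha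
  simp only [noiseShift, noiseVariance, Fintype.sum_sum_type, Sum.elim_inl, Sum.elim_inr,
    NNReal.coe_pow, Pi.smul_apply, smul_eq_mul, ite_pow, ite_div, ne_eq, OfNat.ofNat_ne_zero,
    not_false_eq_true, zero_pow, zero_div, Finset.sum_ite_mem, Finset.univ_inter,
    Finset.sum_const, nsmul_eq_mul]
  refine add_le_add ?_ ?_
  · have hshare : (H.card : ℝ) * ((a / H.card) ^ 2 / (ση : ℝ) ^ 2) =
        a ^ 2 / ((H.card : ℝ) * (ση : ℝ) ^ 2) := by
      rcases eq_or_ne (H.card : ℝ) 0 with h | h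
      · simp [h]
      · field_simp
    rw [hshare]
    gcongr
  · rw [← Finset.sum_div]
    refine div_le_div_of_nonneg_right (Finset.sum_le_sum fun e _ => ?_) (sq_nonneg _)
    rw [mul_pow]
    exact mul_le_of_le_one_left (sq_nonneg _) ha2

theorem gopaOn_le_of_honestFlow (hv : v ∈ H) (hy : IsHonestFlow H G v y)
    (hX : ∀ u, u ≠ v → X u = X' u) {ση σΔ : ℝ≥0} (hση : 0 < ση) (hσΔ : 0 < σΔ) {θ ε : ℝ}
    (hθ : 1 / ((H.card : ℝ) * (ση : ℝ) ^ 2) + (∑ e, y e ^ 2) / (σΔ : ℝ) ^ 2 ≤ θ)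
    (hε : θ / 2 ≤ ε) {O : Set (View H)} (hO : MeasurableSet O) :
    gopaOn H ση σΔ G X O ≤ ENNReal.ofReal (Real.exp ε) * gopaOn H ση σΔ G X' O +
      ENNReal.ofReal (Real.exp (-((ε - θ / 2) ^ 2 / (2 * θ)))) := by
  have hdiff : |(X v : ℝ) - X' v| ≤ 1 := by
    obtain ⟨hX0, hX1⟩ := (X v).2
    obtain ⟨hX0', hX1'⟩ := (X' v).2
    exact abs_le.2 ⟨by linarith, by linarith⟩
  have hθ_pos : 0 < θ := by
    have hcard : 0 < (H.card : ℝ) := by exact_mod_cast Finset.card_pos.2 ⟨v, hv⟩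
    have : 0 < (ση : ℝ) := hση
    exact lt_of_lt_of_le (by positivity) hθ
  have hpre : {z : Fin n ⊕ Sym2 (Fin n) → ℝ | view H G X (z ∘ Sum.inl) (z ∘ Sum.inr) ∈ O} =
      (fun z => z + noiseShift H ((X v : ℝ) - X' v) y) ⁻¹'
        {z | view H G X' (z ∘ Sum.inl) (z ∘ Sum.inr) ∈ O} :=
    Set.ext fun z => iff_of_eq (congrArg (· ∈ O) (view_eq_view_add_noiseShift hv hy hX z))
  rw [gopaOn_apply H ση σΔ G X hO, gopaOn_apply H ση σΔ G X' hO, hpre]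
  exact gaussianPi_preimage_add_le (noiseVariance_ne_zero hση hσΔ) _ hθ_pos
    ((sum_noiseShift_sq_div_le hdiff H ση σΔ y).trans hθ) hε (measurableSet_view_mem G X' hO)

end FixedGraph

/-! ### Duality between flows and potentials -/

theorem exists_mem_range_inner_eq {E F : Type*} [AddCommGroup E] [Module ℝ E]
    [NormedAddCommGroup F] [InnerProductSpace ℝ F] [FiniteDimensional ℝ F] (D : E →ₗ[ℝ] F)
    (l : E →ₗ[ℝ] ℝ) {R : ℝ} (hR : 0 ≤ R) (hl : ∀ f, l f ^ 2 ≤ R * ‖D f‖ ^ 2) :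
    ∃ z ∈ LinearMap.range D, ‖z‖ ^ 2 ≤ R ∧ ∀ f, inner ℝ z (D f) = l f := by
  have hker : l ∈ (LinearMap.ker D).dualAnnihilator := by
    refine (Submodule.mem_dualAnnihilator l).2 fun f hf => ?_
    have h := hl f
    rw [LinearMap.mem_ker.1 hf] at h
    exact pow_eq_zero_iff two_ne_zero |>.1 (le_antisymm (by simpa using h) (sq_nonneg _))
  rw [← LinearMap.range_dualMap_eq_dualAnnihilator_ker] at hker
  obtain ⟨g, rfl⟩ := hker
  set z : LinearMap.range D := (InnerProductSpace.toDual ℝ (LinearMap.range D)).symm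
    (g.domRestrict (LinearMap.range D)).toContinuousLinearMap
  have hz : ∀ f, inner ℝ (z : F) (D f) = g (D f) := fun f =>
    InnerProductSpace.toDual_symm_apply (x := (⟨D f, f, rfl⟩ : LinearMap.range D))
  refine ⟨z, z.2, ?_, hz⟩
  obtain ⟨f, hf⟩ := z.2
  have hsq : (‖(z : F)‖ ^ 2) ^ 2 ≤ R * ‖(z : F)‖ ^ 2 := by
    have h := hl f
    rwa [LinearMap.dualMap_apply, ← hz f, hf, real_inner_self_eq_norm_sq] at h
  nlinarith [sq_nonneg ‖(z : F)‖]

open Classical in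
/-- The Dirichlet energy of `f` on the graph induced on `H`. Every edge contributes once, in the
direction in which `f` decreases. -/
noncomputable def dirichlet {V : Type*} (H : Finset V) (G : SimpleGraph V) (f : V → ℝ) : ℝ :=
  ∑ p ∈ G.interedges H H, ((f p.1 - f p.2)⁺) ^ 2

section Duality

variable {n : ℕ} {H : Finset (Fin n)} {G : SimpleGraph (Fin n)} {v : Fin n}

open Classical in
/-- The differences of a function along the edges inside `H`, counted from the smaller end of an
edge to the larger one. -/
noncomputable def honestGrad (H : Finset (Fin n)) (G : SimpleGraph (Fin n)) :
    (Fin n → ℝ) →ₗ[ℝ] EuclideanSpace ℝ (Sym2 (Fin n)) where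
  toFun f := WithLp.toLp 2 fun e =>
    if e ∈ G.edgeSet ∧ e.inf ∈ H ∧ e.sup ∈ H then f e.inf - f e.sup else 0
  map_add' f g := by
    ext e
    simp only [PiLp.add_apply, Pi.add_apply]
    split_ifs <;> ring
  map_smul' a f := by
    ext e
    simp only [PiLp.smul_apply, Pi.smul_apply, smul_eq_mul, RingHom.id_apply]
    split_ifs <;> ring

open Classical in
theorem honestGrad_mk (f : Fin n → ℝ) (u w : Fin n) :
    honestGrad H G f s(u, w) = if G.Adj u w ∧ u ∈ H ∧ w ∈ H then
      (if u < w then f u - f w else f w - f u) else 0 := by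
  rcases lt_or_ge u w with h | h
  · simp [honestGrad, h, h.le]
  · simp [honestGrad, h, not_lt.2 h, and_comm]

theorem honestGrad_mk_sq (f : Fin n → ℝ) {u w : Fin n} (hG : G.Adj u w) (hu : u ∈ H)
    (hw : w ∈ H) : honestGrad H G f s(u, w) ^ 2 = (f u - f w) ^ 2 := by
  rw [honestGrad_mk, if_pos ⟨hG, hu, hw⟩]
  split_ifs
  · rfl
  · exact sub_sq_comm _ _

theorem dirichlet_le_norm_honestGrad_sq (H : Finset (Fin n)) (G : SimpleGraph (Fin n))
    (f : Fin n → ℝ) : dirichlet H G f ≤ ‖honestGrad H G f‖ ^ 2 := by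
  classical
  rw [EuclideanSpace.real_norm_sq_eq, dirichlet]
  set T := (G.interedges H H).filter fun p => f p.2 < f p.1
  have hinj : Set.InjOn (fun p : Fin n × Fin n => s(p.1, p.2)) T := fun p hp q hq hpq => by
    rcases Sym2.mk_eq_mk_iff.1 hpq with h | h
    · exact h
    · have hlt := (Finset.mem_filter.1 hp).2
      rw [h] at hlt
      exact absurd hlt (Finset.mem_filter.1 hq).2.not_gt
  calc ∑ p ∈ G.interedges H H, ((f p.1 - f p.2)⁺) ^ 2 = ∑ p ∈ T, ((f p.1 - f p.2)⁺) ^ 2 := by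
        refine (Finset.sum_filter_of_ne fun p _ hp => ?_).symm
        by_contra! hle
        exact hp (by rw [posPart_eq_zero.2 (sub_nonpos.2 hle), zero_pow two_ne_zero])
    _ = ∑ p ∈ T, honestGrad H G f s(p.1, p.2) ^ 2 := Finset.sum_congr rfl fun p hp => by
        obtain ⟨hp, hlt⟩ := Finset.mem_filter.1 hp
        obtain ⟨hu, hw, hG⟩ := (G.mem_interedges_iff).1 hp
        rw [posPart_eq_self.2 (sub_nonneg.2 hlt.le), honestGrad_mk_sq f hG hu hw]
    _ = ∑ e ∈ T.image fun p => s(p.1, p.2), honestGrad H G f e ^ 2 :=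
        (Finset.sum_image (f := fun e => honestGrad H G f e ^ 2) hinj).symm
    _ ≤ _ := Finset.sum_le_univ_sum_of_nonneg fun _ => sq_nonneg _

theorem inner_honestGrad_single {y : EuclideanSpace ℝ (Sym2 (Fin n))}
    (hy : ∀ u ∉ H, ∀ w, y s(u, w) = 0) {u : Fin n} (hu : u ∈ H) :
    inner ℝ y (honestGrad H G (Pi.single u 1)) = ∑ w, pairNoise G y u w := by
  simp only [PiLp.inner_apply, RCLike.inner_apply, conj_trivial]
  symm
  refine Fintype.sum_of_injective (fun w => s(u, w)) (fun _ _ h => Sym2.congr_right.1 h) _ _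
    (fun e he => ?_) fun w => ?_
  · induction e with | _ a b
    have ha : a ≠ u := fun h => he ⟨b, by simp [h]⟩
    have hb : b ≠ u := fun h => he ⟨a, by simp [h, Sym2.eq_swap]⟩
    simp [honestGrad_mk, ha, hb]
  · by_cases hG : G.Adj u w
    · have hne : w ≠ u := hG.ne'
      by_cases hw : w ∈ H
      · by_cases hlt : u < w <;> simp [pairNoise, honestGrad_mk, hG, hu, hw, hlt, hne]
      · simp [pairNoise, honestGrad_mk, hw, Sym2.eq_swap (a := u), hy w hw u]
    · simp [pairNoise, honestGrad_mk, hG]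

theorem exists_isHonestFlow {R : ℝ} (hR : 0 ≤ R)
    (h : ∀ f : Fin n → ℝ, (f v - (∑ u ∈ H, f u) / H.card) ^ 2 ≤ R * dirichlet H G f) :
    ∃ y, IsHonestFlow H G v y ∧ ∑ e, y e ^ 2 ≤ R := by
  set l : (Fin n → ℝ) →ₗ[ℝ] ℝ :=
    LinearMap.proj v - (1 / (H.card : ℝ)) • ∑ u ∈ H, LinearMap.proj u
  have l_apply : ∀ f, l f = f v - (∑ u ∈ H, f u) / H.card := fun f => by
    simp only [l, LinearMap.sub_apply, LinearMap.smul_apply, LinearMap.sum_apply,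
      LinearMap.proj_apply, smul_eq_mul]
    ring
  obtain ⟨z, ⟨f₀, rfl⟩, hz_norm, hz_inner⟩ := exists_mem_range_inner_eq (honestGrad H G) l hR
    fun f => by
      rw [l_apply]
      exact (h f).trans (mul_le_mul_of_nonneg_left (dirichlet_le_norm_honestGrad_sq H G f) hR)
  have hsupp : ∀ u ∉ H, ∀ w, honestGrad H G f₀ s(u, w) = 0 := fun u hu w => by
    rw [honestGrad_mk, if_neg fun h => hu h.2.1]
  refine ⟨honestGrad H G f₀, ⟨hsupp, fun u hu => ?_⟩, ?_⟩
  · rw [← inner_honestGrad_single hsupp hu, hz_inner, l_apply]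
    simp [Pi.single_apply, hu, eq_comm]
  · rwa [EuclideanSpace.real_norm_sq_eq] at hz_norm

end Duality

/-! ### The Dirichlet energy and chains of level sets -/

section Potentials

variable {V : Type*} {H : Finset V} {G : SimpleGraph V} {f : V → ℝ}

theorem dirichlet_neg (H : Finset V) (G : SimpleGraph V) (f : V → ℝ) :
    dirichlet H G (-f) = dirichlet H G f := by
  classical
  refine Finset.sum_nbij' Prod.swap Prod.swap (fun p hp => ?_) (fun p hp => ?_)
    (fun _ _ => rfl) (fun _ _ => rfl) fun p _ => ?_
  · exact G.swap_mem_interedges_iff.2 hp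
  · exact G.swap_mem_interedges_iff.2 hp
  · simp only [Pi.neg_apply, Prod.fst_swap, Prod.snd_swap, neg_sub_neg]

theorem dirichlet_sub_const (H : Finset V) (G : SimpleGraph V) (f : V → ℝ) (a : ℝ) :
    dirichlet H G (fun x => f x - a) = dirichlet H G f := by
  simp only [dirichlet, sub_sub_sub_cancel_right]

theorem dirichlet_nonneg (H : Finset V) (G : SimpleGraph V) (f : V → ℝ) : 0 ≤ dirichlet H G f :=
  Finset.sum_nonneg fun _ _ => sq_nonneg _

theorem posPart_sub_sq_add_negPart_sub_sq_le (a b : ℝ) :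
    ((a⁺ - b⁺)⁺) ^ 2 + ((b⁻ - a⁻)⁺) ^ 2 ≤ ((a - b)⁺) ^ 2 := by
  rcases le_total a b with h | h
  · rw [posPart_eq_zero.2 (sub_nonpos.2 (posPart_mono h)),
      posPart_eq_zero.2 (sub_nonpos.2 (negPart_anti h)), posPart_eq_zero.2 (sub_nonpos.2 h)]
    norm_num
  · have hpos := sub_nonneg.2 (posPart_mono h)
    have hneg := sub_nonneg.2 (negPart_anti h)
    have hsum : a - b = (a⁺ - b⁺) + (b⁻ - a⁻) := by
      linarith [posPart_sub_negPart a, posPart_sub_negPart b]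
    rw [posPart_eq_self.2 hpos, posPart_eq_self.2 hneg, posPart_eq_self.2 (sub_nonneg.2 h), hsum]
    nlinarith [mul_nonneg hpos hneg]

theorem dirichlet_posPart_add_dirichlet_negPart_le (H : Finset V) (G : SimpleGraph V)
    (f : V → ℝ) : dirichlet H G f⁺ + dirichlet H G f⁻ ≤ dirichlet H G f := by
  rw [← dirichlet_neg H G f⁻]
  simp only [dirichlet, ← Finset.sum_add_distrib, Pi.neg_apply, neg_sub_neg, Pi.posPart_apply,
    Pi.negPart_apply]
  exact Finset.sum_le_sum fun p _ => posPart_sub_sq_add_negPart_sub_sq_le _ _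

open Classical in
/-- The edges inside `H`, as ordered pairs, across which `f` drops from at least `s` to at
most `t`. -/
noncomputable def crossing (H : Finset V) (G : SimpleGraph V) (f : V → ℝ) (s t : ℝ) :
    Finset (V × V) :=
  G.interedges {x ∈ H | s ≤ f x} {x ∈ H | f x ≤ t}

theorem mem_crossing {s t : ℝ} {p : V × V} : p ∈ crossing H G f s t ↔
    (p.1 ∈ H ∧ s ≤ f p.1) ∧ (p.2 ∈ H ∧ f p.2 ≤ t) ∧ G.Adj p.1 p.2 := by
  simp only [crossing, SimpleGraph.mem_interedges_iff, Finset.mem_filter]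

theorem sum_drop_le_posPart {T : ℕ → ℝ} (hT : Antitone T) (N : ℕ) (a b : ℝ) :
    ∑ i ∈ Finset.range N, (if T i ≤ a ∧ b ≤ T (i + 1) then T i - T (i + 1) else 0) ≤
      (a - b)⁺ := by
  set φ : ℕ → ℝ := fun i => max b (min a (T i))
  have hstep : ∀ i, (if T i ≤ a ∧ b ≤ T (i + 1) then T i - T (i + 1) else 0) ≤
      φ i - φ (i + 1) := fun i => by
    have h := hT i.le_succ
    split_ifs with hab
    · simp only [φ, min_eq_right hab.1, min_eq_right (h.trans hab.1), max_eq_right hab.2,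
        max_eq_right (hab.2.trans h), le_refl]
    · exact sub_nonneg.2 (max_le_max le_rfl (min_le_min le_rfl h))
  calc _ ≤ ∑ i ∈ Finset.range N, (φ i - φ (i + 1)) := Finset.sum_le_sum fun i _ => hstep i
    _ = φ 0 - φ N := Finset.sum_range_sub' φ N
    _ ≤ max b a - b := sub_le_sub (max_le_max le_rfl (min_le_left _ _)) (le_max_left _ _)
    _ = (a - b)⁺ := by rw [posPart_def, ← sub_self b, max_sub_sub_right, max_comm]

theorem sum_card_crossing_mul_sq_le_dirichlet (H : Finset V) (G : SimpleGraph V) (f : V → ℝ)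
    {T : ℕ → ℝ} (hT : Antitone T) (N : ℕ) :
    ∑ i ∈ Finset.range N with T (i + 1) < T i,
      (crossing H G f (T i) (T (i + 1))).card * (T i - T (i + 1)) ^ 2 ≤ dirichlet H G f := by
  classical
  set drop : ℕ → V × V → ℝ := fun i p =>
    if T i ≤ f p.1 ∧ f p.2 ≤ T (i + 1) then T i - T (i + 1) else 0
  have drop_nonneg : ∀ i p, 0 ≤ drop i p := fun i p => by
    simp only [drop]
    split_ifs
    exacts [sub_nonneg.2 (hT i.le_succ), le_rfl]
  have hcard : ∀ i, ((crossing H G f (T i) (T (i + 1))).card : ℝ) * (T i - T (i + 1)) ^ 2 ≤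
      ∑ p ∈ G.interedges H H, drop i p ^ 2 := fun i => by
    rw [← nsmul_eq_mul, ← Finset.sum_const]
    calc _ = ∑ p ∈ crossing H G f (T i) (T (i + 1)), drop i p ^ 2 :=
          Finset.sum_congr rfl fun p hp => by
            obtain ⟨⟨-, hs⟩, ⟨-, ht⟩, -⟩ := mem_crossing.1 hp
            simp only [drop, if_pos (And.intro hs ht)]
      _ ≤ _ := Finset.sum_le_sum_of_subset_of_nonneg
          (G.interedges_mono (Finset.filter_subset _ _) (Finset.filter_subset _ _))
          fun _ _ _ => sq_nonneg _
  calc _ ≤ ∑ i ∈ Finset.range N, ∑ p ∈ G.interedges H H, drop i p ^ 2 :=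
        (Finset.sum_le_sum_of_subset_of_nonneg (Finset.filter_subset _ _)
          fun _ _ _ => by positivity).trans (Finset.sum_le_sum fun i _ => hcard i)
    _ = ∑ p ∈ G.interedges H H, ∑ i ∈ Finset.range N, drop i p ^ 2 := Finset.sum_comm
    _ ≤ ∑ p ∈ G.interedges H H, (∑ i ∈ Finset.range N, drop i p) ^ 2 :=
        Finset.sum_le_sum fun p _ => Finset.sum_sq_le_sq_sum_of_nonneg fun i _ => drop_nonneg i p
    _ ≤ dirichlet H G f := Finset.sum_le_sum fun p _ => pow_le_pow_left₀
        (Finset.sum_nonneg fun i _ => drop_nonneg i p) (sum_drop_le_posPart hT N _ _) 2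

theorem sq_sum_mul_drop_le (H : Finset V) (G : SimpleGraph V) (f : V → ℝ) {T : ℕ → ℝ}
    (hT : Antitone T) {N : ℕ} (w : ℕ → ℝ) {e : ℕ → ℝ} (he : ∀ i, 0 < e i)
    (hcard : ∀ i < N, T (i + 1) < T i → e i ≤ (crossing H G f (T i) (T (i + 1))).card) :
    (∑ i ∈ Finset.range N, w i * (T i - T (i + 1))) ^ 2 ≤
      (∑ i ∈ Finset.range N, w i ^ 2 / e i) * dirichlet H G f := by
  have henergy : ∑ i ∈ Finset.range N, e i * (T i - T (i + 1)) ^ 2 ≤ dirichlet H G f := by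
    refine le_trans ?_ (sum_card_crossing_mul_sq_le_dirichlet H G f hT N)
    rw [Finset.sum_filter]
    refine Finset.sum_le_sum fun i hi => ?_
    split_ifs with hlt
    · exact mul_le_mul_of_nonneg_right (hcard i (Finset.mem_range.1 hi) hlt) (sq_nonneg _)
    · rw [le_antisymm (not_lt.1 hlt) (hT i.le_succ), sub_self, zero_pow two_ne_zero, mul_zero]
  calc _ ≤ (∑ i ∈ Finset.range N, w i ^ 2 / e i) *
        ∑ i ∈ Finset.range N, e i * (T i - T (i + 1)) ^ 2 :=
      Finset.sum_sq_le_sum_mul_sum_of_sq_le_mul _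
        (fun i _ => div_nonneg (sq_nonneg _) (he i).le)
        (fun i _ => mul_nonneg (he i).le (sq_nonneg _))
        fun i _ => by have := (he i).ne'; exact le_of_eq (by field_simp)
    _ ≤ _ := mul_le_mul_of_nonneg_left henergy
        (Finset.sum_nonneg fun i _ => div_nonneg (sq_nonneg _) (he i).le)

/-! ### Quantiles -/

/-- The `j`-th largest value of `g` on `H`, counted from `j = 1`, if there is one and it is
positive, and `0` otherwise. -/
noncomputable def quantile (H : Finset V) (g : V → ℝ) (j : ℕ) : ℝ :=
  (insert 0 {t ∈ H.image g | j ≤ (H.filter fun x => t ≤ g x).card}).max'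
    (Finset.insert_nonempty _ _)

variable {g : V → ℝ} {i j : ℕ}

theorem quantile_nonneg (H : Finset V) (g : V → ℝ) (j : ℕ) : 0 ≤ quantile H g j :=
  Finset.le_max' _ _ (Finset.mem_insert_self _ _)

theorem le_card_of_quantile_pos (h : 0 < quantile H g j) :
    j ≤ (H.filter fun x => quantile H g j ≤ g x).card := by
  rcases Finset.mem_insert.1 (Finset.max'_mem _ _ : quantile H g j ∈ _) with h0 | hmem
  · exact absurd h0 h.ne'
  · exact (Finset.mem_filter.1 hmem).2

theorem card_quantile_lt_lt (H : Finset V) (g : V → ℝ) (hj : 1 ≤ j) :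
    (H.filter fun x => quantile H g j < g x).card < j := by
  by_contra! hle
  obtain ⟨x, hx, hmin⟩ := (H.filter fun x => quantile H g j < g x).exists_min_image g
    (Finset.card_pos.1 (hj.trans hle))
  obtain ⟨hxH, hlt⟩ := Finset.mem_filter.1 hx
  refine hlt.not_ge (Finset.le_max' _ _ (Finset.mem_insert_of_mem (Finset.mem_filter.2
    ⟨Finset.mem_image_of_mem g hxH, hle.trans (Finset.card_le_card fun y hy => ?_)⟩)))
  exact Finset.mem_filter.2 ⟨(Finset.mem_filter.1 hy).1, hmin y hy⟩

theorem quantile_anti (hi : 1 ≤ i) (hij : i ≤ j) : quantile H g j ≤ quantile H g i := by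
  by_contra! hlt
  have hj := le_card_of_quantile_pos ((quantile_nonneg H g i).trans_lt hlt)
  have hsub := Finset.card_le_card
    (Finset.monotone_filter_right H fun x _ (hx : quantile H g j ≤ g x) => hlt.trans_le hx)
  have := card_quantile_lt_lt H g hi
  omega

theorem quantile_eq_zero (h : (H.filter fun x => 0 < g x).card < j) : quantile H g j = 0 := by
  by_contra hne
  have hpos := (quantile_nonneg H g j).lt_of_ne' hne
  have hj := le_card_of_quantile_pos hpos
  have hsub := Finset.card_le_card
    (Finset.monotone_filter_right H fun x _ (hx : quantile H g j ≤ g x) => hpos.trans_le hx)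
  omega

theorem exists_median (H : Finset V) (f : V → ℝ) :
    ∃ M, 2 * (H.filter fun x => M < f x).card ≤ H.card ∧
      2 * (H.filter fun x => f x < M).card ≤ H.card := by
  rcases H.eq_empty_or_nonempty with rfl | hH
  · exact ⟨0, by simp⟩
  obtain ⟨x₀, -, hmin⟩ := H.exists_min_image f hH
  obtain ⟨j, hj⟩ : ∃ j, j = (H.card + 1) / 2 := ⟨_, rfl⟩
  refine ⟨quantile H (fun x => f x - f x₀) j + f x₀, ?_, ?_⟩
  · have h := card_quantile_lt_lt H (fun x => f x - f x₀) (j := j)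
      (by have := hH.card_pos; omega)
    simp only [lt_sub_iff_add_lt] at h
    omega
  · rcases (quantile_nonneg H (fun x => f x - f x₀) j).eq_or_lt with h0 | hpos
    · rw [← h0, Finset.filter_false_of_mem fun x hx => by simpa using hmin x hx]
      simp
    · have h := le_card_of_quantile_pos hpos
      have hsplit := Finset.card_filter_add_card_filter_not (s := H)
        (fun x => f x < quantile H (fun x => f x - f x₀) j + f x₀)
      simp only [le_sub_iff_add_le] at h
      simp only [not_lt] at hsplit
      omega

end Potentials

/-! ### Potentials on an expanding graph -/

section Expansion

variable {V : Type*} {H : Finset V} {G : SimpleGraph V} {c : ℝ}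

/-- A pair of sets of honest users on which expansion is tested: `Q` contains `A`, is less than
twice as large, and contains at most half of the honest users. -/
structure ExpansionPair (H A Q : Finset V) : Prop where
  subset : A ⊆ Q
  subset_honest : Q ⊆ H
  nonempty : A.Nonempty
  card_lt : Q.card < 2 * A.card
  card_le : 2 * Q.card ≤ H.card

open Classical in
/-- The graph induced on `H` expands with constant `c`: for every expansion pair `(A, Q)` at least
`c |A| (1 - |Q| / |H|)` edges join `A` to the part of `H` outside `Q`. -/
def Expands (H : Finset V) (G : SimpleGraph V) (c : ℝ) : Prop :=
  ∀ A Q : Finset V, ExpansionPair H A Q →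
    c * A.card * (H.card - Q.card) / H.card ≤ (G.interedges A (H \ Q)).card

open Classical in
/-- The neighbours of `v` among the honest users. -/
noncomputable def honestNeighborFinset (H : Finset V) (G : SimpleGraph V) (v : V) : Finset V :=
  {w ∈ H | G.Adj v w}

section Crossing

variable {f : V → ℝ} {s t : ℝ} {a : ℕ}

theorem Expands.le_card_crossing (hG : Expands H G c) (hts : t < s) (ha : 1 ≤ a)
    (hs : a ≤ (H.filter fun x => s ≤ f x).card) (ht : (H.filter fun x => t < f x).card < 2 * a)
    (ht' : 2 * (H.filter fun x => t < f x).card ≤ H.card) :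
    c * a * (H.card - (H.filter fun x => t < f x).card) / H.card ≤ (crossing H G f s t).card := by
  classical
  obtain ⟨A, hA, rfl⟩ := Finset.exists_subset_card_eq hs
  have hAQ : A ⊆ H.filter fun x => t < f x := hA.trans
    (Finset.monotone_filter_right H fun _ _ hx => hts.trans_le hx)
  refine (hG A _ ⟨hAQ, Finset.filter_subset _ _, Finset.card_pos.1 ha, ht, ht'⟩).trans
    (Nat.cast_le.2 (Finset.card_le_card (G.interedges_mono hA fun x hx => ?_)))
  obtain ⟨hxH, hx⟩ := Finset.mem_sdiff.1 hx
  exact Finset.mem_filter.2 ⟨hxH, not_lt.1 fun h => hx (Finset.mem_filter.2 ⟨hxH, h⟩)⟩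

theorem Expands.le_card_crossing_quantile (hG : Expands H G c) (ha : 1 ≤ a)
    (hf : 2 * (H.filter fun x => 0 < f x).card ≤ H.card) (hts : quantile H f (2 * a) < s)
    (hs : s ≤ quantile H f a) : ∃ q : ℕ, q ≤ 2 * a ∧ 2 * q ≤ H.card ∧
      c * a * (H.card - q) / H.card ≤ (crossing H G f s (quantile H f (2 * a))).card := by
  have ht := quantile_nonneg H f (2 * a)
  have hcard := card_quantile_lt_lt H f (j := 2 * a) (by omega)
  have hhalf := Finset.card_le_card (Finset.monotone_filter_right H
    fun x _ (hx : quantile H f (2 * a) < f x) => ht.trans_lt hx)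
  exact ⟨_, hcard.le, by omega, hG.le_card_crossing hts ha
    ((le_card_of_quantile_pos ((ht.trans_lt hts).trans_le hs)).trans
      (Finset.card_le_card (Finset.monotone_filter_right H fun _ _ hx => hs.trans hx)))
    hcard (by omega)⟩

theorem Expands.div_le_card_crossing_quantile (hc : 0 < c) (hG : Expands H G c) (ha : 1 ≤ a)
    (hf : 2 * (H.filter fun x => 0 < f x).card ≤ H.card) (hH : 0 < H.card)
    (hts : quantile H f (2 * a) < s) (hs : s ≤ quantile H f a) :
    c / (1 / a + 4 / H.card) ≤ (crossing H G f s (quantile H f (2 * a))).card := by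
  obtain ⟨q, hqa, hqH, hcross⟩ := hG.le_card_crossing_quantile ha hf hts hs
  refine le_trans ?_ hcross
  have hH0 : (0 : ℝ) < H.card := Nat.cast_pos.2 hH
  have : (0 : ℝ) < a := Nat.cast_pos.2 ha
  have hqa' : (q : ℝ) ≤ 2 * a := by exact_mod_cast hqa
  have hqH' : 2 * (q : ℝ) ≤ H.card := by exact_mod_cast hqH
  rw [div_le_div_iff₀ (by positivity) hH0]
  have hexp : c * a * (H.card - q) * (1 / a + 4 / H.card) =
      c * ((H.card - q) * (H.card + 4 * a) / H.card) := by field_simp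
  rw [hexp]
  refine mul_le_mul_of_nonneg_left ?_ hc.le
  rw [le_div_iff₀ hH0]
  nlinarith [Nat.cast_nonneg (α := ℝ) q]

theorem Expands.half_le_card_crossing_quantile (hc : 0 < c) (hG : Expands H G c) (ha : 1 ≤ a)
    (hf : 2 * (H.filter fun x => 0 < f x).card ≤ H.card) (hH : 0 < H.card)
    (hts : quantile H f (2 * a) < s) (hs : s ≤ quantile H f a) :
    c * a / 2 ≤ (crossing H G f s (quantile H f (2 * a))).card := by
  obtain ⟨q, -, hqH, hcross⟩ := hG.le_card_crossing_quantile ha hf hts hs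
  refine le_trans ?_ hcross
  have hqH' : 2 * (q : ℝ) ≤ H.card := by exact_mod_cast hqH
  rw [le_div_iff₀ (Nat.cast_pos.2 hH)]
  nlinarith [mul_nonneg hc.le (Nat.cast_nonneg (α := ℝ) a)]

theorem card_honestNeighborFinset_add_two_le {v : V} (hv : v ∈ H) {J : ℕ} (hts : t < f v)
    (ht : (H.filter fun x => t < f x).card < J) :
    (honestNeighborFinset H G v).card + 2 ≤ (crossing H G f (f v) t).card + J := by
  classical
  have hvQ : v ∈ H.filter fun x => t < f x := Finset.mem_filter.2 ⟨hv, hts⟩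
  have hcover : honestNeighborFinset H G v ⊆ (crossing H G f (f v) t).image Prod.snd ∪
      (H.filter fun x => t < f x).erase v := fun w hw => by
    obtain ⟨hwH, hvw⟩ := Finset.mem_filter.1 hw
    rcases le_or_gt (f w) t with h | h
    · exact Finset.mem_union_left _ (Finset.mem_image.2
        ⟨(v, w), mem_crossing.2 ⟨⟨hv, le_rfl⟩, ⟨hwH, h⟩, hvw⟩, rfl⟩)
    · exact Finset.mem_union_right _ (Finset.mem_erase.2
        ⟨hvw.ne', Finset.mem_filter.2 ⟨hwH, h⟩⟩)
  have hcard := (Finset.card_le_card hcover).trans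
    ((Finset.card_union_le _ _).trans (Nat.add_le_add_right Finset.card_image_le _))
  rw [Finset.card_erase_of_mem hvQ] at hcard
  have := Finset.card_pos.2 ⟨v, hvQ⟩
  omega

end Crossing

/-- The levels `g v` and the quantiles of order `J`, `2J`, `4J`, ... below it. Their gaps are
crossed by the edges at `v`, and then by the edges that expansion provides. -/
noncomputable def levelChain (H : Finset V) (g : V → ℝ) (v : V) (J : ℕ) : ℕ → ℝ
  | 0 => g v
  | i + 1 => min (quantile H g (2 ^ i * J)) (g v)

section LevelChain

variable {g : V → ℝ} {v : V} {J i : ℕ}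

theorem levelChain_antitone (hJ : 1 ≤ J) : Antitone (levelChain H g v J) :=
  antitone_nat_of_succ_le fun i => by
    cases i with
    | zero => exact min_le_right _ _
    | succ i => exact min_le_min_right _ (quantile_anti (Nat.mul_pos (by positivity) hJ)
        (Nat.mul_le_mul_right _ (Nat.pow_le_pow_right two_pos i.le_succ)))

theorem levelChain_succ_eq (hJ : 1 ≤ J) (h : levelChain H g v J (i + 1) < levelChain H g v J i) :
    levelChain H g v J (i + 1) = quantile H g (2 ^ i * J) ∧ quantile H g (2 ^ i * J) < g v := by
  have hlt : quantile H g (2 ^ i * J) < g v := by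
    by_contra! hle
    rw [show levelChain H g v J (i + 1) = g v from min_eq_right hle] at h
    exact h.not_ge (levelChain_antitone hJ i.zero_le)
  exact ⟨min_eq_left hlt.le, hlt⟩

theorem levelChain_log_eq_zero (hJ : 2 ≤ J) (hgv : 0 ≤ g v) :
    levelChain H g v J (Nat.log 2 H.card + 1) = 0 := by
  have hlast : H.card < 2 ^ Nat.log 2 H.card * J :=
    (Nat.lt_pow_succ_log_self one_lt_two _).trans_le
      (by rw [pow_succ]; exact Nat.mul_le_mul_left _ hJ)
  rw [levelChain, quantile_eq_zero ((Finset.card_filter_le _ _).trans_lt hlast), min_eq_left hgv]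

theorem le_card_crossing_levelChain_zero (hv : v ∈ H) (hJ : 1 ≤ J) {d : ℝ}
    (hdeg : d ≤ (honestNeighborFinset H G v).card)
    (h : levelChain H g v J 1 < levelChain H g v J 0) :
    d + 1 - J ≤ (crossing H G g (levelChain H g v J 0) (levelChain H g v J 1)).card := by
  obtain ⟨heq, hlt⟩ := levelChain_succ_eq hJ h
  rw [pow_zero, one_mul] at heq hlt
  rw [heq, levelChain]
  have hcount := card_honestNeighborFinset_add_two_le (G := G) hv hlt (card_quantile_lt_lt H g hJ)
  rw [← Nat.cast_le (α := ℝ)] at hcount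
  push_cast at hcount
  linarith

theorem Expands.le_card_crossing_levelChain_succ (hc : 0 < c) (hG : Expands H G c) (hJ : 1 ≤ J)
    (hH : 0 < H.card) (hg : 2 * (H.filter fun x => 0 < g x).card ≤ H.card)
    (h : levelChain H g v J (i + 2) < levelChain H g v J (i + 1)) :
    c / (1 / (2 ^ i * J) + 4 / H.card) ≤
      (crossing H G g (levelChain H g v J (i + 1)) (levelChain H g v J (i + 2))).card := by
  obtain ⟨heq, -⟩ := levelChain_succ_eq hJ h
  rw [pow_succ', mul_assoc] at heq
  rw [heq] at h ⊢
  have hcount := hG.div_le_card_crossing_quantile hc (Nat.mul_pos (by positivity) hJ) hg hH h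
    (min_le_left _ _)
  push_cast at hcount
  exact hcount

theorem sum_inv_chain_weights_le (hc : 0 < c) {J m : ℝ} (hJ : 0 < J) (hm : 0 < m) (N : ℕ) :
    ∑ i ∈ Finset.range N, 1 / (c / (1 / (2 ^ i * J) + 4 / m)) ≤ (2 / J + 4 * N / m) / c := by
  have hterm : ∀ i : ℕ, 1 / (c / (1 / (2 ^ i * J) + 4 / m)) =
      (1 / 2) ^ i * (1 / J / c) + 4 / m / c := fun i => by
    rw [one_div_pow]
    field_simp
  simp_rw [hterm]
  rw [Finset.sum_add_distrib, ← Finset.sum_mul, Finset.sum_const, Finset.card_range, nsmul_eq_mul]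
  calc _ ≤ 2 * (1 / J / c) + N * (4 / m / c) := by
        gcongr
        exact sum_geometric_two_le N
    _ = _ := by field_simp

theorem Expands.sq_apply_le (hc : 0 < c) (hG : Expands H G c) (hv : v ∈ H) {d : ℝ} (hJ : 2 ≤ J)
    (hJd : J < d + 1) (hdeg : d ≤ (honestNeighborFinset H G v).card) (hgv : 0 ≤ g v)
    (hg : 2 * (H.filter fun x => 0 < g x).card ≤ H.card) :
    g v ^ 2 ≤ (1 / (d + 1 - J) + (2 / J + 4 * (Nat.log 2 H.card : ℝ) / H.card) / c) *
      dirichlet H G g := by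
  have hJ1 : 1 ≤ J := one_le_two.trans hJ
  have hJR : (0 : ℝ) < J := Nat.cast_pos.2 hJ1
  have hH : 0 < H.card := Finset.card_pos.2 ⟨v, hv⟩
  have hHR : (0 : ℝ) < H.card := Nat.cast_pos.2 hH
  obtain ⟨e, he0, hes⟩ : ∃ e : ℕ → ℝ, e 0 = d + 1 - J ∧
      ∀ i, e (i + 1) = c / (1 / (2 ^ i * J) + 4 / H.card) :=
    ⟨fun | 0 => d + 1 - J | i + 1 => c / (1 / (2 ^ i * J) + 4 / H.card), rfl, fun _ => rfl⟩
  have he : ∀ i, 0 < e i := fun i => by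
    cases i with
    | zero => rw [he0]; linarith
    | succ i => rw [hes]; positivity
  have hchain := sq_sum_mul_drop_le H G g (levelChain_antitone (H := H) (g := g) (v := v) hJ1)
    (N := Nat.log 2 H.card + 1) (fun _ => 1) he fun i _ hlt => by
      cases i with
      | zero => exact he0.trans_le (le_card_crossing_levelChain_zero hv hJ1 hdeg hlt)
      | succ i => exact (hes i).trans_le (hG.le_card_crossing_levelChain_succ hc hJ1 hH hg hlt)
  simp only [one_mul, one_pow] at hchain
  rw [Finset.sum_range_sub', levelChain_log_eq_zero hJ hgv, sub_zero, levelChain,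
    Finset.sum_range_succ'] at hchain
  refine hchain.trans (mul_le_mul_of_nonneg_right ?_ (dirichlet_nonneg H G g))
  simp only [he0, hes]
  rw [add_comm]
  gcongr
  exact sum_inv_chain_weights_le hc hJR hHR _

end LevelChain

section Mean

variable {g : V → ℝ}

theorem sub_le_sum_drop {T : ℕ → ℝ} (hT : Antitone T) (N : ℕ) {x : ℝ} (hx : x ≤ T 0) :
    x - T N ≤ ∑ i ∈ Finset.range N, if T (i + 1) < x then T i - T (i + 1) else 0 := by
  have hstep : ∀ i, min (T i) x - min (T (i + 1)) x ≤
      if T (i + 1) < x then T i - T (i + 1) else 0 := fun i => by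
    split_ifs with h
    · rw [min_eq_left h.le]
      exact sub_le_sub_right (min_le_left _ _) _
    · rw [min_eq_right (not_lt.1 h), min_eq_right ((not_lt.1 h).trans (hT i.le_succ)), sub_self]
  calc x - T N ≤ min (T 0) x - min (T N) x := by
        rw [min_eq_right hx]
        exact sub_le_sub_left (min_le_left _ _) _
    _ = ∑ i ∈ Finset.range N, (min (T i) x - min (T (i + 1)) x) :=
        (Finset.sum_range_sub' (fun i => min (T i) x) N).symm
    _ ≤ _ := Finset.sum_le_sum fun i _ => hstep i

theorem quantile_two_pow_antitone (H : Finset V) (g : V → ℝ) :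
    Antitone fun i => quantile H g (2 ^ i) := fun _ _ hij =>
  quantile_anti Nat.one_le_two_pow (Nat.pow_le_pow_right two_pos hij)

theorem sum_le_sum_two_pow_mul_drop {N : ℕ} (hN : (H.filter fun x => 0 < g x).card < 2 ^ N) :
    ∑ x ∈ H, g x ≤ ∑ i ∈ Finset.range N,
      2 * 2 ^ i * (quantile H g (2 ^ i) - quantile H g (2 ^ (i + 1))) := by
  have hanti := quantile_two_pow_antitone H g
  have htop : ∀ x ∈ H, g x ≤ quantile H g (2 ^ 0) := fun x hx => by
    by_contra! hlt
    have := card_quantile_lt_lt H g (j := 2 ^ 0) le_rfl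
    exact Finset.card_ne_zero_of_mem (Finset.mem_filter.2 ⟨hx, hlt⟩) (Nat.lt_one_iff.1 this)
  calc ∑ x ∈ H, g x
      ≤ ∑ x ∈ H, ∑ i ∈ Finset.range N, (if quantile H g (2 ^ (i + 1)) < g x then
          quantile H g (2 ^ i) - quantile H g (2 ^ (i + 1)) else 0) :=
        Finset.sum_le_sum fun x hx => by
          have := sub_le_sum_drop hanti N (htop x hx)
          rwa [quantile_eq_zero hN, sub_zero] at this
    _ = ∑ i ∈ Finset.range N, ((H.filter fun x => quantile H g (2 ^ (i + 1)) < g x).card : ℝ) *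
          (quantile H g (2 ^ i) - quantile H g (2 ^ (i + 1))) := by
        rw [Finset.sum_comm]
        refine Finset.sum_congr rfl fun i _ => ?_
        rw [← Finset.sum_filter, Finset.sum_const, nsmul_eq_mul]
    _ ≤ _ := Finset.sum_le_sum fun i _ => by
        refine mul_le_mul_of_nonneg_right ?_ (sub_nonneg.2 (hanti i.le_succ))
        rw [← pow_succ']
        exact_mod_cast (card_quantile_lt_lt H g Nat.one_le_two_pow).le

theorem Expands.sq_mean_le (hc : 0 < c) (hG : Expands H G c) (hH : 0 < H.card)
    (hg0 : ∀ x, 0 ≤ g x) (hg : 2 * (H.filter fun x => 0 < g x).card ≤ H.card) :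
    ((∑ x ∈ H, g x) / H.card) ^ 2 ≤ 8 / (c * H.card) * dirichlet H G g := by
  have hHR : (0 : ℝ) < H.card := Nat.cast_pos.2 hH
  set N := Nat.log 2 H.card
  have hlast : (H.filter fun x => 0 < g x).card < 2 ^ N := by
    have : H.card < 2 ^ N * 2 := by
      rw [← pow_succ]
      exact Nat.lt_pow_succ_log_self one_lt_two _
    omega
  have hmean : (∑ x ∈ H, g x) / H.card ≤ ∑ i ∈ Finset.range N,
      2 * 2 ^ i / H.card * (quantile H g (2 ^ i) - quantile H g (2 ^ (i + 1))) := by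
    refine (div_le_div_of_nonneg_right (sum_le_sum_two_pow_mul_drop hlast) hHR.le).trans_eq ?_
    rw [Finset.sum_div]
    exact Finset.sum_congr rfl fun i _ => by ring
  have hchain := sq_sum_mul_drop_le H G g (quantile_two_pow_antitone H g) (N := N)
    (fun i => 2 * 2 ^ i / H.card) (e := fun i => c * 2 ^ i / 2) (fun i => by positivity)
    fun i _ hlt => by
      have := hG.half_le_card_crossing_quantile hc (a := 2 ^ i) Nat.one_le_two_pow hg hH
        (by rwa [← pow_succ']) le_rfl
      rw [← pow_succ'] at this
      exact_mod_cast this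
  have hweights : ∑ i ∈ Finset.range N, (2 * 2 ^ i / H.card : ℝ) ^ 2 / (c * 2 ^ i / 2) ≤
      8 / (c * H.card) := by
    have hterm : ∀ i : ℕ, (2 * 2 ^ i / H.card : ℝ) ^ 2 / (c * 2 ^ i / 2) =
        2 ^ i * (8 / (c * H.card) / H.card) := fun i => by field_simp; norm_num
    simp_rw [hterm]
    have hpow : (2 : ℝ) ^ N ≤ H.card := by exact_mod_cast Nat.pow_log_le_self 2 hH.ne'
    rw [← Finset.sum_mul, geom_sum_eq (by norm_num)]
    calc _ ≤ (H.card : ℝ) * (8 / (c * H.card) / H.card) := by gcongr; linarith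
      _ = _ := by field_simp
  calc _ ≤ _ := pow_le_pow_left₀ (div_nonneg (Finset.sum_nonneg fun x _ => hg0 x) hHR.le) hmean 2
    _ ≤ _ := hchain
    _ ≤ _ := mul_le_mul_of_nonneg_right hweights (dirichlet_nonneg H G g)

end Mean

theorem add_sq_le_of_sq_le {x y R S A B : ℝ} (hR : 0 ≤ R) (hS : 0 ≤ S) (hA : 0 ≤ A) (hB : 0 ≤ B)
    (hx : x ^ 2 ≤ R * A) (hy : y ^ 2 ≤ S * B) : (x + y) ^ 2 ≤ (R + S) * (A + B) := by
  have hcross : 2 * (x * y) ≤ R * B + S * A := by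
    have hprod : (x * y) ^ 2 ≤ (R * B) * (S * A) := by
      calc (x * y) ^ 2 = x ^ 2 * y ^ 2 := mul_pow x y 2
        _ ≤ (R * A) * (S * B) := mul_le_mul hx hy (sq_nonneg _) (mul_nonneg hR hA)
        _ = _ := by ring
    refine abs_le_of_sq_le_sq' ?_ (by positivity) |>.2
    nlinarith [sq_nonneg (R * B - S * A)]
  nlinarith

section PotentialBound

variable {v : V} {d : ℝ} {J : ℕ}

/-- The deviation of `f v` from the mean is at most `f⁺ v` plus the mean of `f⁻`, and the two parts
of `f` share its energy. -/
theorem Expands.sq_sub_mean_le_of_median (hc : 0 < c) (hG : Expands H G c) (hv : v ∈ H)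
    (hJ : 2 ≤ J) (hJd : J < d + 1) (hdeg : d ≤ (honestNeighborFinset H G v).card) {f : V → ℝ}
    (hpos : 2 * (H.filter fun x => 0 < f x).card ≤ H.card)
    (hneg : 2 * (H.filter fun x => f x < 0).card ≤ H.card)
    (hf : 0 ≤ f v - (∑ u ∈ H, f u) / H.card) :
    (f v - (∑ u ∈ H, f u) / H.card) ^ 2 ≤
      (1 / (d + 1 - J) + (2 / J + 4 * (Nat.log 2 H.card : ℝ) / H.card) / c + 8 / (c * H.card)) *
        dirichlet H G f := by
  have hH : 0 < H.card := Finset.card_pos.2 ⟨v, hv⟩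
  have : (0 : ℝ) < J := Nat.cast_pos.2 (by omega)
  have : 0 < d + 1 - J := by linarith
  have hpoint := hG.sq_apply_le hc hv hJ hJd hdeg (g := f⁺) (posPart_nonneg (f v))
    (by simpa only [Pi.posPart_apply, posPart_pos_iff] using hpos)
  have hmean := hG.sq_mean_le hc hH (g := f⁻) (fun x => negPart_nonneg (f x))
    (by simpa only [Pi.negPart_apply, negPart_pos_iff] using hneg)
  have hle : f v - (∑ u ∈ H, f u) / H.card ≤ f⁺ v + (∑ u ∈ H, f⁻ u) / H.card := by
    have hsum : -(∑ u ∈ H, f u) ≤ ∑ u ∈ H, f⁻ u := by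
      rw [← Finset.sum_neg_distrib]
      exact Finset.sum_le_sum fun u _ => neg_le_negPart (f u)
    have := div_le_div_of_nonneg_right hsum (Nat.cast_nonneg (α := ℝ) H.card)
    rw [neg_div] at this
    linarith [show f v ≤ f⁺ v from le_posPart (f v)]
  calc _ ≤ _ := pow_le_pow_left₀ hf hle 2
    _ ≤ _ := add_sq_le_of_sq_le (by positivity) (by positivity) (dirichlet_nonneg H G f⁺)
        (dirichlet_nonneg H G f⁻) hpoint hmean
    _ ≤ _ := mul_le_mul_of_nonneg_left (dirichlet_posPart_add_dirichlet_negPart_le H G f)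
        (by positivity)

theorem Expands.sq_sub_mean_le (hc : 0 < c) (hG : Expands H G c) (hv : v ∈ H)
    (hJ : 2 ≤ J) (hJd : J < d + 1) (hdeg : d ≤ (honestNeighborFinset H G v).card) (f : V → ℝ) :
    (f v - (∑ u ∈ H, f u) / H.card) ^ 2 ≤
      (1 / (d + 1 - J) + (2 / J + 4 * (Nat.log 2 H.card : ℝ) / H.card) / c + 8 / (c * H.card)) *
        dirichlet H G f := by
  obtain ⟨M, habove, hbelow⟩ := exists_median H f
  set g : V → ℝ := fun x => f x - M
  have hpos : 2 * (H.filter fun x => 0 < g x).card ≤ H.card := by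
    simpa only [g, sub_pos] using habove
  have hneg : 2 * (H.filter fun x => g x < 0).card ≤ H.card := by
    simpa only [g, sub_neg] using hbelow
  have hdev : f v - (∑ u ∈ H, f u) / H.card = g v - (∑ u ∈ H, g u) / H.card := by
    have : (H.card : ℝ) ≠ 0 := Nat.cast_ne_zero.2 (Finset.card_ne_zero_of_mem hv)
    simp only [g, Finset.sum_sub_distrib, Finset.sum_const, nsmul_eq_mul]
    field_simp
    ring
  rw [hdev, ← dirichlet_sub_const H G f M]
  rcases le_total 0 (g v - (∑ u ∈ H, g u) / H.card) with h | h
  · exact hG.sq_sub_mean_le_of_median hc hv hJ hJd hdeg hpos hneg h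
  · have hdev_neg : (-g) v - (∑ u ∈ H, (-g) u) / H.card =
        -(g v - (∑ u ∈ H, g u) / H.card) := by
      simp only [Pi.neg_apply, Finset.sum_neg_distrib]
      ring
    have := hG.sq_sub_mean_le_of_median hc hv hJ hJd hdeg (f := -g)
      (by simpa only [Pi.neg_apply, neg_pos] using hneg)
      (by simpa only [Pi.neg_apply, neg_lt_zero] using hpos) (by linarith)
    rwa [hdev_neg, neg_sq, dirichlet_neg] at this

end PotentialBound

end Expansion

/-! ### Moment generating functions of random selections -/

theorem choose_le_choose_succ_mul {M N k : ℕ} (hM : M + 1 ≤ N) (hk : k ≤ N) :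
    (M.choose k : ℝ) ≤ (M + 1).choose k * (1 - (k : ℝ) / N) := by
  rcases lt_or_ge M k with hMk | hMk
  · have : (k : ℝ) / N ≤ 1 := div_le_one_of_le₀ (by exact_mod_cast hk) (Nat.cast_nonneg N)
    rw [Nat.choose_eq_zero_of_lt hMk, Nat.cast_zero]
    exact mul_nonneg (Nat.cast_nonneg _) (by linarith)
  · have hsucc : (M.choose k : ℝ) * (M + 1) = (M + 1).choose k * (M + 1 - k) := by
      have := congrArg (Nat.cast (R := ℝ)) (Nat.choose_mul_succ_eq M k)
      push_cast [Nat.cast_sub (hMk.trans M.le_succ)] at this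
      exact this
    have : (M : ℝ) + 1 ≤ N := by exact_mod_cast hM
    calc (M.choose k : ℝ) = (M + 1).choose k * (1 - k / (M + 1)) := by
          field_simp
          linarith
      _ ≤ _ := by gcongr

theorem choose_sub_le {N k j : ℕ} (hk : k ≤ N) (hj : j ≤ N) :
    ((N - j).choose k : ℝ) ≤ N.choose k * (1 - (k : ℝ) / N) ^ j := by
  have hq : (k : ℝ) / N ≤ 1 := div_le_one_of_le₀ (by exact_mod_cast hk) (Nat.cast_nonneg N)
  induction j with
  | zero => simp
  | succ j ih =>
    have hsub : N - (j + 1) + 1 = N - j := by omega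
    calc ((N - (j + 1)).choose k : ℝ) ≤ (N - j).choose k * (1 - (k : ℝ) / N) :=
          hsub ▸ choose_le_choose_succ_mul (by omega) hk
      _ ≤ N.choose k * (1 - (k : ℝ) / N) ^ j * (1 - (k : ℝ) / N) :=
          mul_le_mul_of_nonneg_right (ih (by omega)) (by linarith)
      _ = _ := by rw [pow_succ, mul_assoc]

section Powerset

variable {V : Type*} [DecidableEq V] {U C : Finset V} {k : ℕ}

theorem pow_card_inter_eq_sum_disjoint (S : Finset V) {z : ℝ} (hz : z ≠ 0) :
    z ^ (S ∩ C).card = z ^ C.card * ∑ T ∈ C.powerset with Disjoint T S, (1 / z - 1) ^ T.card := by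
  have hfilter : C.powerset.filter (fun T => Disjoint T S) = (C \ S).powerset := by
    ext T
    simp only [Finset.mem_filter, Finset.mem_powerset, Finset.subset_sdiff]
  have hbinom := Finset.sum_pow_mul_eq_add_pow (1 / z - 1) 1 (C \ S)
  simp only [one_pow, mul_one, sub_add_cancel] at hbinom
  rw [hfilter, hbinom, ← Finset.card_inter_add_card_sdiff C S, Finset.inter_comm S, pow_add,
    mul_assoc, ← mul_pow, mul_one_div_cancel hz, one_pow, mul_one]

theorem card_filter_disjoint_powersetCard {T : Finset V} (hT : T ⊆ U) :
    ((U.powersetCard k).filter fun S => Disjoint T S).card = (U.card - T.card).choose k := by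
  have hfilter : (U.powersetCard k).filter (fun S => Disjoint T S) = (U \ T).powersetCard k := by
    ext S
    simp only [Finset.mem_filter, Finset.mem_powersetCard, Finset.subset_sdiff]
    rw [disjoint_comm]
    tauto
  rw [hfilter, Finset.card_powersetCard, Finset.card_sdiff_of_subset hT]

theorem sum_pow_card_inter_le (hC : C ⊆ U) (hk : k ≤ U.card) {z : ℝ} (hz : 0 < z) (hz1 : z ≤ 1) :
    ∑ S ∈ U.powersetCard k, z ^ (S ∩ C).card ≤
      U.card.choose k * (1 - (k : ℝ) / U.card * (1 - z)) ^ C.card := by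
  have hy : 0 ≤ 1 / z - 1 := sub_nonneg.2 ((one_le_div hz).2 hz1)
  have hswap : ∑ S ∈ U.powersetCard k, ∑ T ∈ C.powerset with Disjoint T S, (1 / z - 1) ^ T.card =
      ∑ T ∈ C.powerset, ((U.card - T.card).choose k : ℝ) * (1 / z - 1) ^ T.card := by
    simp_rw [Finset.sum_filter]
    rw [Finset.sum_comm]
    refine Finset.sum_congr rfl fun T hT => ?_
    rw [← Finset.sum_filter, Finset.sum_const, nsmul_eq_mul,
      card_filter_disjoint_powersetCard ((Finset.mem_powerset.1 hT).trans hC)]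
  have hbinom := Finset.sum_pow_mul_eq_add_pow ((1 - (k : ℝ) / U.card) * (1 / z - 1)) 1 C
  simp only [one_pow, mul_one] at hbinom
  simp_rw [pow_card_inter_eq_sum_disjoint _ hz.ne']
  rw [← Finset.mul_sum, hswap]
  calc z ^ C.card * ∑ T ∈ C.powerset, ((U.card - T.card).choose k : ℝ) * (1 / z - 1) ^ T.card
      ≤ z ^ C.card * ∑ T ∈ C.powerset,
          (U.card.choose k : ℝ) * ((1 - (k : ℝ) / U.card) * (1 / z - 1)) ^ T.card := by
        refine mul_le_mul_of_nonneg_left (Finset.sum_le_sum fun T hT => ?_) (by positivity)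
        rw [mul_pow, ← mul_assoc]
        exact mul_le_mul_of_nonneg_right (choose_sub_le hk
          (Finset.card_le_card ((Finset.mem_powerset.1 hT).trans hC))) (by positivity)
    _ = U.card.choose k * (z * ((1 - (k : ℝ) / U.card) * (1 / z - 1) + 1)) ^ C.card := by
        rw [← Finset.mul_sum, hbinom, mul_left_comm, ← mul_pow]
    _ = _ := by
        congr 2
        generalize (k : ℝ) / U.card = t
        field_simp
        ring

end Powerset

section Isolate

variable {ι β R : Type*} [Fintype ι] [DecidableEq ι] [CommSemiring R]

theorem sum_piFinset_prod_erase (t : ι → Finset β) (i : ι) (φ : β → ι → β → R) :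
    ∑ c ∈ Fintype.piFinset t, ∏ j ∈ Finset.univ.erase i, φ (c i) j (c j) =
      ∑ s ∈ t i, ∏ j ∈ Finset.univ.erase i, ∑ x ∈ t j, φ s j x := by
  classical
  let ψ : β → ι → β → R := fun s j x => if j = i then (if x = s then 1 else 0) else φ s j x
  have hψ : ∀ s, ∀ j ∈ Finset.univ.erase i, ψ s j = φ s j :=
    fun s j hj => funext fun x => if_neg (Finset.ne_of_mem_erase hj)
  have hψi : ∀ s x, ψ s i x = if x = s then 1 else 0 := fun s x => if_pos rfl
  calc ∑ c ∈ Fintype.piFinset t, ∏ j ∈ Finset.univ.erase i, φ (c i) j (c j)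
      = ∑ c ∈ Fintype.piFinset t, ∑ s ∈ t i, ∏ j, ψ s j (c j) := by
        refine Finset.sum_congr rfl fun c hc => ?_
        simp_rw [← Finset.mul_prod_erase Finset.univ _ (Finset.mem_univ i), hψi, ite_mul, one_mul,
          zero_mul, Finset.sum_ite_eq, if_pos (Fintype.mem_piFinset.1 hc i)]
        exact Finset.prod_congr rfl fun j hj => by rw [hψ _ j hj]
    _ = ∑ s ∈ t i, ∏ j, ∑ x ∈ t j, ψ s j x := by
        rw [Finset.sum_comm]
        exact Finset.sum_congr rfl fun s _ => (Finset.prod_univ_sum t (ψ s)).symm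
    _ = _ := by
        refine Finset.sum_congr rfl fun s hs => ?_
        rw [← Finset.mul_prod_erase Finset.univ _ (Finset.mem_univ i)]
        simp_rw [hψi, Finset.sum_ite_eq', if_pos hs, one_mul]
        exact Finset.prod_congr rfl fun j hj => by rw [hψ _ j hj]

end Isolate

/-- The probability that a user, who selects `k` of the other `n - 1` users, selects a given one. -/
noncomputable def selectProb (n k : ℕ) : ℝ := (k : ℝ) / (n - 1)

section Selections

variable {n k : ℕ} {H : Finset (Fin n)}

theorem selectProb_nonneg (hk : k < n) : 0 ≤ selectProb n k := by
  have : (1 : ℝ) ≤ n := by exact_mod_cast hk.pos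
  exact div_nonneg (Nat.cast_nonneg k) (by linarith)

theorem selectProb_le_one (hk : k < n) : selectProb n k ≤ 1 := by
  have : (k : ℝ) + 1 ≤ n := by exact_mod_cast hk
  exact div_le_one_of_le₀ (by linarith) (by linarith [(Nat.cast_nonneg k : (0 : ℝ) ≤ k)])

theorem div_le_selectProb (hk : k < n) : (k : ℝ) / n ≤ selectProb n k := by
  rcases Nat.eq_zero_or_pos k with rfl | hk0
  · simp [selectProb]
  · have : (1 : ℝ) < n := by exact_mod_cast (show 1 < n by omega)
    unfold selectProb
    gcongr; linarith

theorem card_powersetCard_erase (u : Fin n) (k : ℕ) :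
    ((Finset.univ.erase u).powersetCard k).card = (n - 1).choose k := by
  rw [Finset.card_powersetCard, Finset.card_erase_of_mem (Finset.mem_univ _), Finset.card_univ,
    Fintype.card_fin]

theorem card_honestSelections (H : Finset (Fin n)) (k : ℕ) :
    (honestSelections H k).card = (n - 1).choose k ^ H.card := by
  simp only [honestSelections, Fintype.card_piFinset, card_powersetCard_erase, Finset.prod_const,
    Finset.card_univ, Fintype.card_coe]

theorem sum_pow_card_inter_erase_le (hk : k < n) {u : Fin n} {C : Finset (Fin n)} (hu : u ∉ C)
    {z : ℝ} (hz : 0 < z) (hz1 : z ≤ 1) :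
    ∑ S ∈ (Finset.univ.erase u).powersetCard k, z ^ (S ∩ C).card ≤
      (n - 1).choose k * (1 - selectProb n k * (1 - z)) ^ C.card := by
  have hcard : (Finset.univ.erase u).card = n - 1 := by
    rw [Finset.card_erase_of_mem (Finset.mem_univ _), Finset.card_univ, Fintype.card_fin]
  have h := sum_pow_card_inter_le (U := Finset.univ.erase u) (k := k)
    (Finset.subset_erase.2 ⟨Finset.subset_univ C, hu⟩) (by omega) hz hz1
  rwa [hcard, Nat.cast_sub hk.pos, Nat.cast_one] at h

/-- The number of selections that the members of `A` make in `C`. -/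
def picks (A C : Finset (Fin n)) (c : {u // u ∈ H} → Finset (Fin n)) : ℕ :=
  ∑ u : {u // u ∈ H}, if u.1 ∈ A then (c u ∩ C).card else 0

theorem sum_pow_picks_le (hk : k < n) {A C : Finset (Fin n)} (hA : A ⊆ H) (hAC : Disjoint A C)
    {z : ℝ} (hz : 0 < z) (hz1 : z ≤ 1) :
    ∑ c ∈ honestSelections H k, z ^ picks A C c ≤
      (honestSelections H k).card * ((1 - selectProb n k * (1 - z)) ^ C.card) ^ A.card := by
  set b := (1 - selectProb n k * (1 - z)) ^ C.card
  calc ∑ c ∈ honestSelections H k, z ^ picks A C c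
      = ∏ u : {u // u ∈ H}, ∑ s ∈ (Finset.univ.erase u.1).powersetCard k,
          if u.1 ∈ A then z ^ (s ∩ C).card else 1 := by
        rw [Finset.prod_univ_sum]
        refine Finset.sum_congr rfl fun c _ => ?_
        simp only [picks, ← Finset.prod_pow_eq_pow_sum, pow_ite, pow_zero]
    _ ≤ ∏ u : {u // u ∈ H}, ((n - 1).choose k : ℝ) * (if u.1 ∈ A then b else 1) := by
        refine Finset.prod_le_prod (fun u _ => Finset.sum_nonneg fun s _ => ?_) fun u _ => ?_
        · split_ifs <;> positivity
        · split_ifs with hu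
          · exact sum_pow_card_inter_erase_le hk (Finset.disjoint_left.1 hAC hu) hz hz1
          · simp
    _ = _ := by
        rw [Finset.prod_mul_distrib, Finset.prod_const, Finset.card_univ, Fintype.card_coe,
          card_honestSelections, Nat.cast_pow,
          Finset.prod_coe_sort H fun u => if u ∈ A then b else 1, Finset.prod_ite,
          Finset.prod_const, Finset.prod_const_one, mul_one, Finset.filter_mem_eq_inter,
          Finset.inter_eq_right.2 hA]

/-- The number of honest neighbours of `v` when the honest users select `c`. -/
def honestDegree (v : {u // u ∈ H}) (c : {u // u ∈ H} → Finset (Fin n)) : ℕ :=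
  ((Finset.univ.erase v).filter fun w => w.1 ∈ c v ∨ v.1 ∈ c w).card

theorem sum_ite_mem_or_le (hk : k < n) {v w : Fin n} (hvw : w ≠ v) (S : Finset (Fin n)) {z : ℝ}
    (hz : 0 < z) (hz1 : z ≤ 1) :
    ∑ s ∈ (Finset.univ.erase w).powersetCard k, (if w ∈ S ∨ v ∈ s then z else 1) ≤
      (n - 1).choose k * (if w ∈ S then z else 1 - selectProb n k * (1 - z)) := by
  by_cases hw : w ∈ S
  · simp [hw]
  · have hpow : ∀ s : Finset (Fin n), (if v ∈ s then z else 1) = z ^ (s ∩ {v}).card := fun s => by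
      split_ifs with hv <;> simp [hv]
    simpa only [hw, false_or, if_false, hpow, Finset.card_singleton, pow_one] using
      sum_pow_card_inter_erase_le hk (C := {v}) (by simpa using hvw) hz hz1

theorem prod_univ_erase_coe (v : {u // u ∈ H}) (F : Fin n → ℝ) :
    ∏ w ∈ Finset.univ.erase v, F w.1 = ∏ w ∈ H.erase v.1, F w := by
  refine Finset.prod_bij (fun w _ => w.1) (fun w hw => ?_) (fun _ _ _ _ h => Subtype.ext h)
    (fun w hw => ?_) fun _ _ => rfl
  · exact Finset.mem_erase.2 ⟨Subtype.coe_ne_coe.2 (Finset.ne_of_mem_erase hw), w.2⟩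
  · exact ⟨⟨w, Finset.mem_of_mem_erase hw⟩, Finset.mem_erase.2
      ⟨fun h => Finset.ne_of_mem_erase hw (congrArg Subtype.val h), Finset.mem_univ _⟩, rfl⟩

/-- A user in the selection `S` of `v` contributes `z`; the others are adjacent to `v` only if they
select `v`. -/
theorem prod_sum_ite_mem_or_le (hk : k < n) (v : {u // u ∈ H}) (S : Finset (Fin n)) {z : ℝ}
    (hz : 0 < z) (hz1 : z ≤ 1) {b : ℝ} (hb : b = 1 - selectProb n k * (1 - z)) (hb0 : 0 < b) :
    ∏ w ∈ Finset.univ.erase v, ∑ s ∈ (Finset.univ.erase w.1).powersetCard k,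
      (if w.1 ∈ S ∨ v.1 ∈ s then z else 1) ≤
        ((n - 1).choose k * b) ^ (H.card - 1) * (z / b) ^ (S ∩ H.erase v.1).card := by
  calc _ ≤ ∏ w ∈ Finset.univ.erase v, ((n - 1).choose k : ℝ) * (if w.1 ∈ S then z else b) := by
        refine Finset.prod_le_prod (fun w _ => Finset.sum_nonneg fun s _ => ?_) fun w hw =>
          hb ▸ sum_ite_mem_or_le hk (Subtype.coe_ne_coe.2 (Finset.ne_of_mem_erase hw)) S hz hz1
        split_ifs <;> positivity
    _ = ∏ w ∈ H.erase v.1, ((n - 1).choose k * b) * (if w ∈ S then z / b else 1) := by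
        rw [prod_univ_erase_coe v fun w => ((n - 1).choose k : ℝ) * (if w ∈ S then z else b)]
        refine Finset.prod_congr rfl fun w _ => ?_
        split_ifs <;> field_simp
    _ = _ := by
        rw [Finset.prod_mul_distrib, Finset.prod_const, Finset.card_erase_of_mem v.2,
          Finset.prod_ite, Finset.prod_const, Finset.prod_const_one, mul_one,
          Finset.filter_mem_eq_inter, Finset.inter_comm]

theorem sum_pow_honestDegree_le (hk : k < n) (v : {u // u ∈ H}) {z : ℝ} (hz : 0 < z)
    (hz1 : z ≤ 1) :
    ∑ c ∈ honestSelections H k, z ^ honestDegree v c ≤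
      (honestSelections H k).card *
        ((1 - selectProb n k * (1 - z)) * (1 - selectProb n k) + selectProb n k * z) ^
          (H.card - 1) := by
  have hκ0 := selectProb_nonneg hk
  have hκ1 := selectProb_le_one hk
  set κ := selectProb n k
  set b := 1 - κ * (1 - z) with hb
  set N : ℝ := ((n - 1).choose k : ℝ)
  have hzb : z ≤ b := by nlinarith
  have hb0 : 0 < b := hz.trans_le hzb
  have hW : (H.erase v.1).card = H.card - 1 := Finset.card_erase_of_mem v.2
  have hsucc : H.card = H.card - 1 + 1 := (Nat.sub_add_cancel (Finset.card_pos.2 ⟨_, v.2⟩)).symm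
  calc ∑ c ∈ honestSelections H k, z ^ honestDegree v c
      = ∑ S ∈ (Finset.univ.erase v.1).powersetCard k, ∏ w ∈ Finset.univ.erase v,
          ∑ s ∈ (Finset.univ.erase w.1).powersetCard k, (if w.1 ∈ S ∨ v.1 ∈ s then z else 1) := by
        rw [← sum_piFinset_prod_erase
          (fun w : {u // u ∈ H} => (Finset.univ.erase w.1).powersetCard k) v
          fun S w s => if w.1 ∈ S ∨ v.1 ∈ s then z else 1]
        refine Finset.sum_congr rfl fun c _ => ?_
        rw [honestDegree, Finset.prod_ite, Finset.prod_const, Finset.prod_const_one, mul_one]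
    _ ≤ (N * b) ^ (H.card - 1) * (N * (1 - κ * (1 - z / b)) ^ (H.card - 1)) := by
        refine (Finset.sum_le_sum fun S _ => prod_sum_ite_mem_or_le hk v S hz hz1 hb hb0).trans ?_
        rw [← Finset.mul_sum, ← hW]
        exact mul_le_mul_of_nonneg_left (sum_pow_card_inter_erase_le hk (Finset.notMem_erase _ _)
          (by positivity) ((div_le_one hb0).2 hzb)) (by positivity)
    _ = N ^ (H.card - 1 + 1) * (b * (1 - κ * (1 - z / b))) ^ (H.card - 1) := by
        rw [mul_pow, mul_pow, pow_succ, mul_mul_mul_comm]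
    _ = _ := by
        rw [card_honestSelections, Nat.cast_pow, ← hsucc]
        congr 2
        field_simp
        ring

end Selections

/-! ### Tail bounds for random selections -/

theorem card_filter_lt_le {α : Type*} (F : Finset α) (X : α → ℕ) {z θ a b : ℝ} (hz : 0 < z)
    (hz1 : z ≤ 1) (ha : θ * -Real.log z ≤ a) (hb : ∑ c ∈ F, z ^ X c ≤ F.card * Real.exp (-b)) :
    ((F.filter fun c => (X c : ℝ) < θ).card : ℝ) ≤ F.card * Real.exp (a - b) := by
  have hexp : 1 ≤ Real.exp a * z ^ θ := by
    rw [Real.rpow_def_of_pos hz, ← Real.exp_add]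
    exact Real.one_le_exp (by linarith)
  have hmarkov : ∑ _c ∈ F.filter fun c => (X c : ℝ) < θ, z ^ θ ≤ ∑ c ∈ F, z ^ X c := by
    refine (Finset.sum_le_sum fun c hc => ?_).trans
      (Finset.sum_le_sum_of_subset_of_nonneg (Finset.filter_subset _ F) fun _ _ _ => by positivity)
    rw [← Real.rpow_natCast]
    exact Real.rpow_le_rpow_of_exponent_ge hz hz1 (Finset.mem_filter.1 hc).2.le
  rw [Finset.sum_const, nsmul_eq_mul] at hmarkov
  calc ((F.filter fun c => (X c : ℝ) < θ).card : ℝ)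
      ≤ (F.filter fun c => (X c : ℝ) < θ).card * (Real.exp a * z ^ θ) :=
        le_mul_of_one_le_right (Nat.cast_nonneg _) hexp
    _ = Real.exp a * ((F.filter fun c => (X c : ℝ) < θ).card * z ^ θ) := by ring
    _ ≤ Real.exp a * (F.card * Real.exp (-b)) :=
        mul_le_mul_of_nonneg_left (hmarkov.trans hb) (Real.exp_pos a).le
    _ = _ := by rw [sub_eq_add_neg, Real.exp_add, mul_left_comm]

theorem quadratic_le_exp {x : ℝ} (h0 : 0 ≤ x) (h1 : x ≤ 1) :
    1 - 1.6 * x + 0.8 * x ^ 2 ≤ Real.exp (-(1.51 * x)) := by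
  have hx3 : x ^ 3 ≤ x ^ 2 := pow_le_pow_of_le_one h0 h1 (by norm_num)
  have hx5 : x ^ 5 ≤ x ^ 4 := pow_le_pow_of_le_one h0 h1 (by norm_num)
  have hx4 : 0 ≤ x ^ 4 := by positivity
  have hhalf : 1 - 0.755 * x + 0.213 * x ^ 2 ≤ Real.exp (-(0.755 * x)) := by
    have hbound := (abs_le.1 (Real.exp_bound (x := -(0.755 * x)) (n := 5)
      (by rw [abs_neg, abs_of_nonneg (by positivity)]; linarith) (by norm_num))).1
    rw [abs_neg, abs_of_nonneg (by positivity : 0 ≤ 0.755 * x)] at hbound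
    norm_num [Finset.sum_range_succ, Nat.factorial] at hbound ⊢
    nlinarith
  calc 1 - 1.6 * x + 0.8 * x ^ 2 ≤ (1 - 0.755 * x + 0.213 * x ^ 2) ^ 2 := by
        have : 0 ≤ x * (0.09 + 0.196025 * x - 0.32163 * x ^ 2 + 0.0453 * x ^ 3) := by
          refine mul_nonneg h0 ?_
          nlinarith [mul_nonneg h0 (sub_nonneg.2 h1), pow_nonneg h0 3,
            mul_nonneg (mul_nonneg h0 h0) (sub_nonneg.2 h1)]
        nlinarith
    _ ≤ Real.exp (-(0.755 * x)) ^ 2 := pow_le_pow_left₀ (by nlinarith) hhalf 2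
    _ = _ := by
        rw [← Real.exp_nat_mul]
        congr 1
        push_cast
        ring

section Tails

variable {n k : ℕ} {H : Finset (Fin n)}

theorem sub_one_le_selectProb_mul (hk : k < n) (hH : H.Nonempty) :
    (k : ℝ) / n * H.card - 1 ≤ selectProb n k * (H.card - 1) := by
  have hm : (1 : ℝ) ≤ H.card := by exact_mod_cast hH.card_pos
  have hkn : (k : ℝ) / n ≤ 1 := div_le_one_of_le₀ (by exact_mod_cast hk.le) (Nat.cast_nonneg n)
  have := mul_le_mul_of_nonneg_right (div_le_selectProb hk) (sub_nonneg.2 hm)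
  linarith

theorem card_honestDegree_lt_le (hk : k < n) (v : {u // u ∈ H}) {L : ℝ}
    (hL : L = (k : ℝ) / n * H.card) :
    (((honestSelections H k).filter fun c => (honestDegree v c : ℝ) < 0.78 * L).card : ℝ) ≤
      (honestSelections H k).card * Real.exp (1.51 - L / 4) := by
  have hκ0 := selectProb_nonneg hk
  have hκ1 := selectProb_le_one hk
  have hκL : L - 1 ≤ selectProb n k * (H.card - 1) := hL ▸ sub_one_le_selectProb_mul hk ⟨_, v.2⟩
  have hmgf := sum_pow_honestDegree_le hk v (z := 1 / 5) (by norm_num) (by norm_num)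
  set κ := selectProb n k
  have hbase : ((1 - κ * (1 - 1 / 5)) * (1 - κ) + κ * (1 / 5)) ^ (H.card - 1) ≤
      Real.exp (-(1.51 * (L - 1))) := by
    calc _ = (1 - 1.6 * κ + 0.8 * κ ^ 2) ^ (H.card - 1) := by ring
      _ ≤ Real.exp (-(1.51 * κ)) ^ (H.card - 1) :=
          pow_le_pow_left₀ (by nlinarith [sq_nonneg (1 - κ)]) (quadratic_le_exp hκ0 hκ1) _
      _ = Real.exp (-(1.51 * (κ * (H.card - 1)))) := by
          rw [← Real.exp_nat_mul, Nat.cast_sub (Finset.card_pos.2 ⟨_, v.2⟩)]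
          congr 1
          push_cast
          ring
      _ ≤ _ := Real.exp_le_exp.2 (by linarith)
  have hlog : 0.78 * L * -Real.log (1 / 5) ≤ 1.26 * L := by
    have hL0 : 0 ≤ L := by rw [hL]; positivity
    rw [one_div, Real.log_inv]
    nlinarith [Real.log_five_lt_d9]
  have htail := card_filter_lt_le (honestSelections H k) (honestDegree v) (by norm_num)
    (by norm_num) hlog (hmgf.trans (mul_le_mul_of_nonneg_left hbase (Nat.cast_nonneg _)))
  rwa [show 1.26 * L - 1.51 * (L - 1) = 1.51 - L / 4 by ring] at htail

theorem card_picks_lt_le (hk : k < n) {A C : Finset (Fin n)} (hA : A ⊆ H) (hAC : Disjoint A C)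
    {M : ℝ} (hM : M = (k : ℝ) / n * A.card * C.card) :
    (((honestSelections H k).filter fun c => (picks A C c : ℝ) < M / 8).card : ℝ) ≤
      (honestSelections H k).card * Real.exp (-(0.615 * M)) := by
  have hκ1 := selectProb_le_one hk
  have hκM : M ≤ selectProb n k * A.card * C.card := by
    rw [hM]
    have := div_le_selectProb hk
    gcongr
  have hmgf := sum_pow_picks_le hk hA hAC (z := 1 / 8) (by norm_num) (by norm_num)
  set κ := selectProb n k
  have hbase : ((1 - κ * (1 - 1 / 8)) ^ C.card) ^ A.card ≤ Real.exp (-(7 / 8 * M)) := by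
    rw [← pow_mul]
    calc _ ≤ Real.exp (-(κ * (7 / 8))) ^ (C.card * A.card) :=
          pow_le_pow_left₀ (by linarith) (by linarith [Real.add_one_le_exp (-(κ * (7 / 8)))]) _
      _ = Real.exp (-(7 / 8 * (κ * A.card * C.card))) := by
          rw [← Real.exp_nat_mul]
          congr 1
          push_cast
          ring
      _ ≤ _ := Real.exp_le_exp.2 (by linarith)
  have hlog : M / 8 * -Real.log (1 / 8) ≤ 0.26 * M := by
    have hM0 : 0 ≤ M := by rw [hM]; positivity
    rw [one_div, Real.log_inv, show (8 : ℝ) = 2 ^ 3 by norm_num, Real.log_pow]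
    push_cast
    nlinarith [Real.log_two_lt_d9]
  have htail := card_filter_lt_le (honestSelections H k) (picks A C) (by norm_num)
    (by norm_num) hlog (hmgf.trans (mul_le_mul_of_nonneg_left hbase (Nat.cast_nonneg _)))
  rwa [show 0.26 * M - 7 / 8 * M = -(0.615 * M) by ring] at htail

end Tails

/-! ### The union bound -/

section Counting

variable {V : Type*} {H : Finset V} {a : ℕ}

theorem card_filter_card_le (ha : 1 ≤ a) (haH : a ≤ H.card) (j : ℕ) :
    ((H.powerset.filter fun B => B.card ≤ j).card : ℝ) ≤
      Real.exp (a + j * Real.log (H.card / a)) := by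
  have ha0 : (0 : ℝ) < a := by exact_mod_cast ha
  have hH0 : (0 : ℝ) < H.card := by exact_mod_cast ha.trans haH
  have haH' : (a : ℝ) / H.card ≤ 1 := (div_le_one hH0).2 (by exact_mod_cast haH)
  have hone : ∀ B ∈ H.powerset.filter fun B => B.card ≤ j,
      (1 : ℝ) ≤ ((a : ℝ) / H.card) ^ B.card * ((H.card : ℝ) / a) ^ j := fun B hB => by
    calc (1 : ℝ) = ((a : ℝ) / H.card) ^ j * ((H.card : ℝ) / a) ^ j := by
          rw [← mul_pow, div_mul_div_cancel₀ hH0.ne', div_self ha0.ne', one_pow]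
      _ ≤ _ := mul_le_mul_of_nonneg_right
          (pow_le_pow_of_le_one (by positivity) haH' (Finset.mem_filter.1 hB).2) (by positivity)
  have hbinom := Finset.sum_pow_mul_eq_add_pow ((a : ℝ) / H.card) 1 H
  simp only [one_pow, mul_one] at hbinom
  calc ((H.powerset.filter fun B => B.card ≤ j).card : ℝ)
      ≤ ∑ B ∈ H.powerset, ((a : ℝ) / H.card) ^ B.card * ((H.card : ℝ) / a) ^ j := by
        rw [Finset.cast_card]
        exact (Finset.sum_le_sum hone).trans (Finset.sum_le_sum_of_subset_of_nonneg
          (Finset.filter_subset _ _) fun _ _ _ => by positivity)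
    _ = ((a : ℝ) / H.card + 1) ^ H.card * ((H.card : ℝ) / a) ^ j := by
        rw [← Finset.sum_mul, hbinom]
    _ ≤ Real.exp (a / H.card) ^ H.card * ((H.card : ℝ) / a) ^ j := by
        gcongr
        exact Real.add_one_le_exp _
    _ = _ := by
        rw [Real.exp_add, ← Real.exp_nat_mul, mul_div_cancel₀ _ hH0.ne', Real.exp_nat_mul,
          Real.exp_log (by positivity)]

theorem choose_card_le_exp (ha : 1 ≤ a) (haH : a ≤ H.card) :
    (H.card.choose a : ℝ) ≤ Real.exp (a + a * Real.log (H.card / a)) := by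
  rw [← Finset.card_powersetCard]
  refine le_trans (Nat.cast_le.2 (Finset.card_le_card fun B hB => ?_))
    (card_filter_card_le ha haH a)
  obtain ⟨hBH, hBa⟩ := Finset.mem_powersetCard.1 hB
  exact Finset.mem_filter.2 ⟨Finset.mem_powerset.2 hBH, hBa.le⟩

theorem card_filter_exists_le {α β : Type*} (F : Finset α) (s : Finset β) (p : β → α → Prop)
    [∀ i, DecidablePred (p i)] [DecidablePred fun c => ∃ i ∈ s, p i c] :
    ((F.filter fun c => ∃ i ∈ s, p i c).card : ℝ) ≤ ∑ i ∈ s, ((F.filter (p i)).card : ℝ) := by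
  classical
  rw [← Nat.cast_sum]
  refine Nat.cast_le.2 ((Finset.card_le_card fun c hc => ?_).trans Finset.card_biUnion_le)
  obtain ⟨hcF, i, hi, hp⟩ := Finset.mem_filter.1 hc
  exact Finset.mem_biUnion.2 ⟨i, hi, Finset.mem_filter.2 ⟨hcF, hp⟩⟩

open Classical in
theorem card_filter_expansionPair_le {A : Finset V} (hA : A.Nonempty) (hAH : A ⊆ H) :
    ((H.powerset.filter (ExpansionPair H A)).card : ℝ) ≤
      Real.exp (A.card + (A.card - 1) * Real.log (H.card / A.card)) := by
  have hsub := card_filter_card_le hA.card_pos (Finset.card_le_card hAH) (A.card - 1)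
  rw [Nat.cast_sub hA.card_pos, Nat.cast_one] at hsub
  refine le_trans (Nat.cast_le.2 (Finset.card_le_card_of_injOn (· \ A) (fun Q hQ => ?_)
    fun Q hQ Q' hQ' h => ?_)) hsub
  · obtain ⟨-, hAQ⟩ := Finset.mem_filter.1 hQ
    refine Finset.mem_coe.2 (Finset.mem_filter.2
      ⟨Finset.mem_powerset.2 (Finset.sdiff_subset.trans hAQ.subset_honest), ?_⟩)
    rw [Finset.card_sdiff_of_subset hAQ.subset]
    have := hAQ.card_lt
    omega
  · rw [← Finset.sdiff_union_of_subset (Finset.mem_filter.1 hQ).2.subset,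
      ← Finset.sdiff_union_of_subset (Finset.mem_filter.1 hQ').2.subset]
    exact congrArg (· ∪ A) h

end Counting

section Exponent

variable {m a L δ : ℝ}

theorem le_of_six_mul_log_le (hm : 81 ≤ m) (hL : 6 * Real.log (m / 3) ≤ L) : 19.77 ≤ L := by
  have hlog : Real.log ((3 : ℝ) ^ 3) ≤ Real.log (m / 3) :=
    Real.log_le_log (by norm_num) (by linarith)
  rw [Real.log_pow] at hlog
  push_cast at hlog
  linarith [Real.log_three_gt_d9]

theorem union_exponent_le_of_ten_mul_le (ha : 1 ≤ a) (ham : 10 * a ≤ m) (hL : 19.77 ≤ L)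
    (hLm : 6 * Real.log (m / 3) ≤ L) :
    2 * a + (2 * a - 2) * Real.log (m / a) + L / 4 - Real.log a + (Real.log 3 - Real.log 2) +
      a * Real.log 2 ≤ 0.615 * (L * a * (1 - 2 * a / m)) := by
  have ha0 : 0 < a := by linarith
  have hl : Real.log (m / a) ≤ L / 6 + (3 / a - 1) := by
    have hsplit : Real.log (m / a) = Real.log (m / 3) + Real.log (3 / a) := by
      rw [← Real.log_mul (by linarith) (by positivity)]
      congr 1
      field_simp
    linarith [Real.log_le_sub_one_of_pos (show 0 < 3 / a by positivity)]
  have hl' := mul_le_mul_of_nonneg_left hl (show 0 ≤ 2 * a - 2 by linarith)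
  have hLa : 0 ≤ L * a := mul_nonneg (by linarith) ha0.le
  have hω : L * a * 0.8 ≤ L * a * (1 - 2 * a / m) := by
    refine mul_le_mul_of_nonneg_left ?_ hLa
    have : 2 * a / m ≤ 0.2 := by rw [div_le_iff₀ (by linarith)]; linarith
    linarith
  have hlog2 : a * Real.log 2 ≤ a * 0.694 :=
    mul_le_mul_of_nonneg_left (by linarith [Real.log_two_lt_d9]) ha0.le
  have hlin : 0 ≤ (L - 19.77) * (0.158 * a + 1 / 12) := mul_nonneg (by linarith) (by linarith)
  have hquad : 6.77 ≤ 2.42 * a + 2 * (3 / a) := by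
    rw [show 2.42 * a + 2 * (3 / a) = (2.42 * a ^ 2 + 6) / a by field_simp; norm_num,
      le_div_iff₀ ha0]
    nlinarith [sq_nonneg (a - 1.4)]
  have hcancel : (2 * a - 2) * (L / 6 + (3 / a - 1)) =
      a * L / 3 - L / 3 + 8 - 2 * a - 2 * (3 / a) := by
    field_simp
    ring
  linarith [Real.log_nonneg ha, Real.log_three_lt_d9, Real.log_two_gt_d9]

theorem union_exponent_le_of_le_ten_mul (h4 : 4 * a ≤ m) (h10 : m ≤ 10 * a) (hm : 81 ≤ m)
    (hL : 19.77 ≤ L) :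
    2 * a + (2 * a - 2) * Real.log (m / a) + L / 4 - Real.log a + (Real.log 3 - Real.log 2) +
      a * Real.log 2 ≤ 0.615 * (L * a * (1 - 2 * a / m)) := by
  have ha0 : 0 < a := by linarith
  have hloga : Real.log 3 ≤ Real.log a := Real.log_le_log (by norm_num) (by linarith)
  obtain ⟨x, rfl⟩ : ∃ x, m = x * a := ⟨m / a, by field_simp⟩
  have hx4 : 4 ≤ x := le_of_mul_le_mul_right h4 ha0
  have hx10 : x ≤ 10 := le_of_mul_le_mul_right h10 ha0
  have hx0 : 0 < x := by linarith
  have hl : Real.log x ≤ x / 6 + 0.793 := by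
    have := Real.log_le_sub_one_of_pos (show 0 < x / 6 by positivity)
    rw [Real.log_div hx0.ne' (by norm_num), show (6 : ℝ) = 2 * 3 by norm_num,
      Real.log_mul (by norm_num) (by norm_num)] at this
    linarith [Real.log_two_lt_d9, Real.log_three_lt_d9]
  have hl' : (2 * a - 2) * Real.log x ≤ 2 * a * (x / 6 + 0.793) :=
    mul_le_mul (by linarith) hl (Real.log_nonneg (by linarith)) (by linarith)
  have hlog2 : a * Real.log 2 ≤ a * 0.694 :=
    mul_le_mul_of_nonneg_left (by linarith [Real.log_two_lt_d9]) ha0.le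
  have hquad : 4.28 + x / 3 ≤ L * (0.615 - 1.23 / x - x / 324) := by
    have hnn : 0 ≤ (x - 4) * (10 - x) := mul_nonneg (by linarith) (by linarith)
    rw [show L * (0.615 - 1.23 / x - x / 324) = L * (0.615 * x - 1.23 - x ^ 2 / 324) / x by
      field_simp, le_div_iff₀ hx0]
    linarith [mul_le_mul_of_nonneg_right hL
      (show 0 ≤ 0.615 * x - 1.23 - x ^ 2 / 324 by linarith)]
  have hL4 : L / 4 ≤ L * (x * a) / 324 := by nlinarith
  have hsplit : 0.615 * (L * a * (1 - 2 * a / (x * a))) =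
      a * (L * (0.615 - 1.23 / x - x / 324)) + L * (x * a) / 324 := by
    field_simp
    ring
  rw [hsplit, mul_div_cancel_right₀ _ ha0.ne']
  linarith [mul_le_mul_of_nonneg_left hquad ha0.le, Real.log_two_gt_d9]

theorem union_exponent_le_of_le_four_mul (h2 : 2 * a ≤ m) (h4 : m ≤ 4 * a) (hm : 81 ≤ m)
    (hL : 19.77 ≤ L) :
    2 * a + (2 * a - 2) * Real.log (m / a) + L / 4 - Real.log a + (Real.log 3 - Real.log 2) +
      a * Real.log 2 ≤ 0.615 * (L * a * (1 / 2)) := by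
  have ha0 : 0 < a := by linarith
  have hloga : Real.log 3 ≤ Real.log a := Real.log_le_log (by norm_num) (by linarith)
  have hl0 : 0 ≤ Real.log (m / a) := Real.log_nonneg ((one_le_div ha0).2 (by linarith))
  have hl : Real.log (m / a) ≤ 1.3864 := by
    have := Real.log_le_log (show 0 < m / a by positivity)
      (show m / a ≤ 2 ^ 2 by rw [div_le_iff₀ ha0]; linarith)
    rw [Real.log_pow] at this
    push_cast at this
    linarith [Real.log_two_lt_d9]
  have hl' : (2 * a - 2) * Real.log (m / a) ≤ 2 * a * 1.3864 :=
    mul_le_mul (by linarith) hl hl0 (by linarith)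
  have hlog2 : a * Real.log 2 ≤ a * 0.694 :=
    mul_le_mul_of_nonneg_left (by linarith [Real.log_two_lt_d9]) ha0.le
  have hLa : 0 ≤ (L - 19.77) * (a - 20.25) := mul_nonneg (by linarith) (by linarith)
  linarith [Real.log_two_gt_d9]

theorem union_exponent_le (hm : 81 ≤ m) (ha : 1 ≤ a) (ham : 2 * a ≤ m) (hδ : 0 < δ)
    (hLδ : 4 * Real.log (2 * m / (3 * δ)) ≤ L) (hLm : 6 * Real.log (m / 3) ≤ L) :
    2 * a + (2 * a - 1) * Real.log (m / a) - 0.615 * (L * a * max (1 - 2 * a / m) (1 / 2)) ≤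
      Real.log δ - a * Real.log 2 := by
  have hL := le_of_six_mul_log_le hm hLm
  have hLa : 0 ≤ L * a := mul_nonneg (by linarith) (by linarith)
  have hmain : 2 * a + (2 * a - 2) * Real.log (m / a) + L / 4 - Real.log a +
      (Real.log 3 - Real.log 2) + a * Real.log 2 ≤
        0.615 * (L * a * max (1 - 2 * a / m) (1 / 2)) := by
    rcases le_total m (4 * a) with h4 | h4
    · exact (union_exponent_le_of_le_four_mul ham h4 hm hL).trans
        (by gcongr; exact le_max_right _ _)
    rcases le_total m (10 * a) with h10 | h10
    · exact (union_exponent_le_of_le_ten_mul h4 h10 hm hL).trans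
        (by gcongr; exact le_max_left _ _)
    · exact (union_exponent_le_of_ten_mul_le ha h10 hL hLm).trans
        (by gcongr; exact le_max_left _ _)
  rw [Real.log_div (by positivity) (by positivity), Real.log_mul (by norm_num) (by linarith),
    Real.log_mul (by norm_num) hδ.ne'] at hLδ
  have hlog : Real.log (m / a) = Real.log m - Real.log a :=
    Real.log_div (by linarith) (by linarith)
  linarith

end Exponent

section Union

variable {n k : ℕ} {H : Finset (Fin n)} {L δ : ℝ}

/-- The selections `c` violate the expansion requirement at the pair `(A, Q)`: the members of `A`
make fewer selections in `H \ Q` than an eighth of what is expected when each honest user selects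
`L` honest users on average. -/
def PicksFew (L : ℝ) (A Q : Finset (Fin n)) (c : {u // u ∈ H} → Finset (Fin n)) : Prop :=
  ExpansionPair H A Q ∧ (picks A (H \ Q) c : ℝ) < L * A.card * (H.card - Q.card) / H.card / 8

/-- The selections `c` meet the expansion requirement at every expansion pair. -/
def PicksExpand (L : ℝ) (c : {u // u ∈ H} → Finset (Fin n)) : Prop :=
  ∀ A Q : Finset (Fin n), ¬ PicksFew L A Q c

open Classical in
theorem card_picksFew_le (hk : k < n) (hL : L = (k : ℝ) / n * H.card) {A Q : Finset (Fin n)}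
    (hAQ : ExpansionPair H A Q) :
    (((honestSelections H k).filter (PicksFew L A Q)).card : ℝ) ≤ (honestSelections H k).card *
      Real.exp (-(0.615 * (L * A.card * max (1 - 2 * (A.card : ℝ) / H.card) (1 / 2)))) := by
  have hQH := Finset.card_le_card hAQ.subset_honest
  have hH : (0 : ℝ) < H.card := by
    exact_mod_cast (hAQ.nonempty.mono (hAQ.subset.trans hAQ.subset_honest)).card_pos
  have hM : L * A.card * (H.card - Q.card) / H.card = (k : ℝ) / n * A.card * (H \ Q).card := by
    rw [Finset.card_sdiff_of_subset hAQ.subset_honest, Nat.cast_sub hQH, hL]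
    field_simp
  have hLA : 0 ≤ L * A.card := by rw [hL]; positivity
  have hmax : max (1 - 2 * (A.card : ℝ) / H.card) (1 / 2) ≤ (H.card - Q.card) / H.card := by
    have hQA : (Q.card : ℝ) ≤ 2 * A.card := by exact_mod_cast hAQ.card_lt.le
    have hQH : 2 * (Q.card : ℝ) ≤ H.card := by exact_mod_cast hAQ.card_le
    rw [sub_div, div_self hH.ne']
    refine max_le (by gcongr) ?_
    have : (Q.card : ℝ) / H.card ≤ 1 / 2 := by rw [div_le_iff₀ hH]; linarith
    linarith
  refine le_trans (Nat.cast_le.2 (Finset.card_le_card (Finset.monotone_filter_right _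
    fun c _ hc => hc.2))) ((card_picks_lt_le hk (hAQ.subset.trans hAQ.subset_honest)
      (Finset.disjoint_sdiff.mono_left hAQ.subset) hM).trans ?_)
  rw [mul_div_assoc]
  gcongr

open Classical in
theorem card_exists_picksFew_le (hk : k < n) (hL : L = (k : ℝ) / n * H.card) {A : Finset (Fin n)}
    (hA : A.Nonempty) (hAH : A ⊆ H) :
    (((honestSelections H k).filter fun c => ∃ Q, PicksFew L A Q c).card : ℝ) ≤
      (honestSelections H k).card * Real.exp (A.card + (A.card - 1) * Real.log (H.card / A.card) -
        0.615 * (L * A.card * max (1 - 2 * (A.card : ℝ) / H.card) (1 / 2))) := by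
  set F := honestSelections H k
  set W := 0.615 * (L * A.card * max (1 - 2 * (A.card : ℝ) / H.card) (1 / 2))
  calc ((F.filter fun c => ∃ Q, PicksFew L A Q c).card : ℝ)
      ≤ (F.filter fun c => ∃ Q ∈ H.powerset.filter (ExpansionPair H A), PicksFew L A Q c).card := by
        refine Nat.cast_le.2 (Finset.card_le_card (Finset.monotone_filter_right F
          fun c _ ⟨Q, hQ⟩ => ⟨Q, Finset.mem_filter.2 ⟨?_, hQ.1⟩, hQ⟩))
        exact Finset.mem_powerset.2 hQ.1.subset_honest
    _ ≤ ∑ Q ∈ H.powerset.filter (ExpansionPair H A), ((F.filter (PicksFew L A Q)).card : ℝ) :=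
        card_filter_exists_le F _ (PicksFew L A)
    _ ≤ (H.powerset.filter (ExpansionPair H A)).card * (F.card * Real.exp (-W)) := by
        rw [← nsmul_eq_mul]
        exact Finset.sum_le_card_nsmul _ _ _
          fun Q hQ => card_picksFew_le hk hL (Finset.mem_filter.1 hQ).2
    _ ≤ Real.exp (A.card + (A.card - 1) * Real.log (H.card / A.card)) *
          (F.card * Real.exp (-W)) :=
        mul_le_mul_of_nonneg_right (card_filter_expansionPair_le hA hAH) (by positivity)
    _ = _ := by rw [sub_eq_add_neg _ W, Real.exp_add _ (-W), mul_left_comm]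

open Classical in
theorem card_exists_picksFew_card_eq_le (hk : k < n) (hH : 81 ≤ H.card)
    (hL : L = (k : ℝ) / n * H.card) (hδ : 0 < δ)
    (hLδ : 4 * Real.log (2 * H.card / (3 * δ)) ≤ L) (hLm : 6 * Real.log (H.card / 3) ≤ L)
    {a : ℕ} (ha : 1 ≤ a) :
    (((honestSelections H k).filter fun c => ∃ A Q, A.card = a ∧ PicksFew L A Q c).card : ℝ) ≤
      (honestSelections H k).card * (δ * (1 / 2) ^ a) := by
  set F := honestSelections H k
  have hpair : ∀ A Q c, PicksFew L A Q c → A ⊆ H ∧ 2 * A.card ≤ H.card :=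
    fun A Q c hc => ⟨hc.1.subset.trans hc.1.subset_honest, (Nat.mul_le_mul_left 2
      (Finset.card_le_card hc.1.subset)).trans hc.1.card_le⟩
  rcases lt_or_ge H.card (2 * a) with haH | haH
  · rw [Finset.filter_eq_empty_iff.2 fun c _ ⟨A, Q, hAa, hc⟩ =>
      haH.not_ge (hAa ▸ (hpair A Q c hc).2), Finset.card_empty, Nat.cast_zero]
    positivity
  set l := Real.log (H.card / a)
  set W := 0.615 * (L * a * max (1 - 2 * (a : ℝ) / H.card) (1 / 2))
  calc ((F.filter fun c => ∃ A Q, A.card = a ∧ PicksFew L A Q c).card : ℝ)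
      ≤ (F.filter fun c => ∃ A ∈ H.powersetCard a, ∃ Q, PicksFew L A Q c).card :=
        Nat.cast_le.2 (Finset.card_le_card (Finset.monotone_filter_right F
          fun c _ ⟨A, Q, hAa, hc⟩ =>
            ⟨A, Finset.mem_powersetCard.2 ⟨(hpair A Q c hc).1, hAa⟩, Q, hc⟩))
    _ ≤ ∑ A ∈ H.powersetCard a, ((F.filter fun c => ∃ Q, PicksFew L A Q c).card : ℝ) :=
        card_filter_exists_le F _ fun A c => ∃ Q, PicksFew L A Q c
    _ ≤ (H.card.choose a) * (F.card * Real.exp (a + (a - 1) * l - W)) := by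
        rw [← nsmul_eq_mul, ← Finset.card_powersetCard]
        refine Finset.sum_le_card_nsmul _ _ _ fun A hA => ?_
        obtain ⟨hAH, rfl⟩ := Finset.mem_powersetCard.1 hA
        exact card_exists_picksFew_le hk hL (Finset.card_pos.1 ha) hAH
    _ ≤ Real.exp (a + a * l) * (F.card * Real.exp (a + (a - 1) * l - W)) :=
        mul_le_mul_of_nonneg_right (choose_card_le_exp ha (by omega)) (by positivity)
    _ = F.card * Real.exp (2 * a + (2 * a - 1) * l - W) := by
        rw [mul_left_comm, ← Real.exp_add]
        congr 2
        ring
    _ ≤ F.card * Real.exp (Real.log δ - a * Real.log 2) :=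
        mul_le_mul_of_nonneg_left (Real.exp_le_exp.2 (union_exponent_le (by exact_mod_cast hH)
          (by exact_mod_cast ha) (by exact_mod_cast haH) hδ hLδ hLm)) (Nat.cast_nonneg _)
    _ = _ := by
        rw [Real.exp_sub, Real.exp_log hδ, Real.exp_nat_mul, Real.exp_log (by norm_num), one_div,
          inv_pow, div_eq_mul_inv]

open Classical in
theorem card_not_picksExpand_le (hk : k < n) (hH : 81 ≤ H.card)
    (hL : L = (k : ℝ) / n * H.card) (hδ : 0 < δ)
    (hLδ : 4 * Real.log (2 * H.card / (3 * δ)) ≤ L) (hLm : 6 * Real.log (H.card / 3) ≤ L) :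
    (((honestSelections H k).filter fun c => ¬ PicksExpand L c).card : ℝ) ≤
      (honestSelections H k).card * δ := by
  set F := honestSelections H k
  let p : ℕ → ({u // u ∈ H} → Finset (Fin n)) → Prop :=
    fun j c => ∃ A Q, A.card = j + 1 ∧ PicksFew L A Q c
  calc ((F.filter fun c => ¬ PicksExpand L c).card : ℝ)
      ≤ (F.filter fun c => ∃ j ∈ Finset.range H.card, p j c).card := by
        refine Nat.cast_le.2 (Finset.card_le_card (Finset.monotone_filter_right F fun c _ hc => ?_))
        simp only [PicksExpand, not_forall, not_not] at hc
        obtain ⟨A, Q, hAQ⟩ := hc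
        have hA := hAQ.1.nonempty.card_pos
        have hAH := Finset.card_le_card (hAQ.1.subset.trans hAQ.1.subset_honest)
        exact ⟨A.card - 1, Finset.mem_range.2 (by omega), A, Q, by omega, hAQ⟩
    _ ≤ ∑ j ∈ Finset.range H.card, ((F.filter (p j)).card : ℝ) :=
        card_filter_exists_le F _ p
    _ ≤ ∑ j ∈ Finset.range H.card, F.card * (δ * (1 / 2) ^ (j + 1)) :=
        Finset.sum_le_sum fun j _ =>
          card_exists_picksFew_card_eq_le hk hH hL hδ hLδ hLm (Nat.le_add_left 1 j)
    _ = F.card * δ * ((∑ j ∈ Finset.range H.card, (1 / 2 : ℝ) ^ j) / 2) := by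
        simp only [Finset.sum_div, Finset.mul_sum, pow_succ]
        exact Finset.sum_congr rfl fun j _ => by ring
    _ ≤ F.card * δ := by
        have hgeom := sum_geometric_two_le H.card
        exact mul_le_of_le_one_right (by positivity) (by linarith)

end Union

/-! ### The energy of the flow -/

section Energy

variable {L : ℝ}

theorem main_terms_le_of_cubic {h : ℝ} (hL : 3 < L)
    (hc : 0 ≤ h * L ^ 3 + (1.113 - 3 * h) * L ^ 2 - 58.339 * L + 192) :
    64 / L ^ 2 + 1.887 / L ≤ 3 / (L - 3) + h := by
  have hL3 : 0 < L - 3 := by linarith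
  have : 0 < L := by linarith
  have hdiff : 3 / (L - 3) + h - (64 / L ^ 2 + 1.887 / L) =
      (h * L ^ 3 + (1.113 - 3 * h) * L ^ 2 - 58.339 * L + 192) / (L ^ 2 * (L - 3)) := by
    field_simp
    ring
  rw [← sub_nonneg, hdiff]
  positivity

-- The tangent line of `L ↦ exp (-L / 6)` at `L = 6 * j`.
theorem pow_mul_le_exp_neg_div_six {j : ℕ} (hj : L ≤ 6 * (j + 1)) :
    (1 / 2.7183) ^ j * (1 + j - L / 6) ≤ Real.exp (-(L / 6)) := by
  have hexp : 1 / 2.7183 ≤ Real.exp (-1) := by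
    rw [Real.exp_neg, ← one_div]
    exact one_div_le_one_div_of_le (Real.exp_pos 1) (by linarith [Real.exp_one_lt_d9])
  calc (1 / 2.7183) ^ j * (1 + j - L / 6)
      ≤ Real.exp (-1) ^ j * Real.exp (j - L / 6) := by
        refine mul_le_mul (pow_le_pow_left₀ (by norm_num) hexp j) ?_ (by linarith) (by positivity)
        linarith [Real.add_one_le_exp (j - L / 6)]
    _ = Real.exp (-(L / 6)) := by
        rw [← Real.exp_nat_mul, ← Real.exp_add]
        ring_nf

theorem main_terms_le (hL : 19.77 ≤ L) :
    64 / L ^ 2 + 1.887 / L ≤ 3 / (L - 3) + 8.28 * Real.exp (-(L / 6)) := by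
  obtain ⟨h, hexp, hcubic⟩ : ∃ h ≤ Real.exp (-(L / 6)), 0 ≤ (8.28 * h) * L ^ 3 +
      (1.113 - 3 * (8.28 * h)) * L ^ 2 - 58.339 * L + 192 := by
    rcases le_total L 33 with h33 | h33
    · refine ⟨_, pow_mul_le_exp_neg_div_six (j := 5) (by norm_num; linarith), ?_⟩
      push_cast
      nlinarith [mul_nonneg (sub_nonneg.2 hL) (sub_nonneg.2 h33),
       mul_nonneg (mul_nonneg (sub_nonneg.2 hL) (sub_nonneg.2 h33)) (sq_nonneg L)]
    rcases le_total L 44 with h44 | h44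
    · refine ⟨_, pow_mul_le_exp_neg_div_six (j := 7) (by norm_num; linarith), ?_⟩
      push_cast
      nlinarith [mul_nonneg (sub_nonneg.2 h33) (sub_nonneg.2 h44),
       mul_nonneg (mul_nonneg (sub_nonneg.2 h33) (sub_nonneg.2 h44)) (sq_nonneg L)]
    rcases le_total L 49 with h49 | h49
    · refine ⟨_, pow_mul_le_exp_neg_div_six (j := 8) (by norm_num; linarith), ?_⟩
      push_cast
      nlinarith [mul_nonneg (sub_nonneg.2 h44) (sub_nonneg.2 h49),
       mul_nonneg (mul_nonneg (sub_nonneg.2 h44) (sub_nonneg.2 h49)) (sq_nonneg L)]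
    · exact ⟨0, (Real.exp_pos _).le, by nlinarith⟩
  exact (main_terms_le_of_cubic (by linarith) hcubic).trans (by gcongr)

theorem exp_neg_div_six_le {m : ℝ} (hm : 0 < m) (hL : 6 * Real.log (m / 3) ≤ L) :
    Real.exp (-(L / 6)) ≤ 3 / m := by
  calc Real.exp (-(L / 6)) ≤ Real.exp (-Real.log (m / 3)) := Real.exp_le_exp.2 (by linarith)
    _ = 3 / m := by rw [← Real.log_inv, Real.exp_log (by positivity), inv_div]

theorem natLog_two_le (m : ℕ) : (Nat.log 2 m : ℝ) ≤ 1.443 * Real.log m := by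
  calc (Nat.log 2 m : ℝ) ≤ Real.log m / Real.log 2 := Real.natLog_le_logb m 2
    _ ≤ 1.443 * Real.log m := by
        rw [div_le_iff₀ (Real.log_pos (by norm_num)), mul_right_comm]
        exact le_mul_of_one_le_left (Real.log_natCast_nonneg m) (by linarith [Real.log_two_gt_d9])

theorem expansion_terms_le {m : ℕ} {J : ℝ} (hm : 0 < m) (hL : 19.77 ≤ L) (hJ : L / 4 ≤ J) :
    (2 / J + 4 * Nat.log 2 m / m) / (L / 8) + 8 / (L / 8 * m) ≤
      64 / L ^ 2 + (2.336 * Real.log m + 3.24) / m := by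
  have hL0 : 0 < L := by linarith
  have : (0 : ℝ) < m := by exact_mod_cast hm
  have hJ2 : 2 / J ≤ 8 / L := by
    rw [div_le_div_iff₀ (by linarith) hL0]
    linarith
  have hLinv : 1 / L ≤ 1 / 19.77 := one_div_le_one_div_of_le (by norm_num) hL
  have hlog := Real.log_natCast_nonneg m
  calc (2 / J + 4 * Nat.log 2 m / m) / (L / 8) + 8 / (L / 8 * m)
      ≤ (8 / L + 4 * (1.443 * Real.log m) / m) / (L / 8) + 8 / (L / 8 * m) := by
        gcongr
        exact natLog_two_le m
    _ = 64 / L ^ 2 + (46.176 * Real.log m + 64) * (1 / L) / m := by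
        field_simp
        ring
    _ ≤ 64 / L ^ 2 + (46.176 * Real.log m + 64) * (1 / 19.77) / m := by gcongr
    _ ≤ 64 / L ^ 2 + (2.336 * Real.log m + 3.24) / m := by
        gcongr
        linarith

theorem energy_bound_le {m J : ℕ} (hm : 81 ≤ m) (hLm : 6 * Real.log (m / 3) ≤ L)
    (hJ : L / 4 ≤ J) (hJ' : J < L / 4 + 1) :
    1 / (0.78 * L + 1 - J) + (2 / J + 4 * Nat.log 2 m / m) / (L / 8) + 8 / (L / 8 * m) ≤
      3 / (L - 3) + (12 + 6 * Real.log m) / m := by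
  have hmR : (81 : ℝ) ≤ m := by exact_mod_cast hm
  have hL := le_of_six_mul_log_le hmR hLm
  have hlog : 4 * Real.log 3 ≤ Real.log m := by
    have h := Real.log_le_log (by norm_num) (show (3 : ℝ) ^ 4 ≤ m by linarith)
    rwa [Real.log_pow] at h
  have hbranch : 1 / (0.78 * L + 1 - J) ≤ 1.887 / L := by
    rw [div_le_div_iff₀ (by linarith) (by linarith)]
    linarith
  have hmain : 64 / L ^ 2 + 1.887 / L ≤ 3 / (L - 3) + 24.84 / m := by
    have hexp := exp_neg_div_six_le (by linarith) hLm
    calc _ ≤ 3 / (L - 3) + 8.28 * Real.exp (-(L / 6)) := main_terms_le hL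
      _ ≤ 3 / (L - 3) + 8.28 * (3 / m) := by gcongr
      _ = _ := by ring
  have hlogs : 24.84 / (m : ℝ) + (2.336 * Real.log m + 3.24) / m ≤ (12 + 6 * Real.log m) / m := by
    rw [← add_div]
    exact div_le_div_of_nonneg_right (by linarith [Real.log_three_gt_d9]) (by linarith)
  linarith [expansion_terms_le (show 0 < m by omega) hL hJ]

end Energy

/-! ### Privacy of the whole process -/

section Graph

variable {n : ℕ} {H : Finset (Fin n)} {L : ℝ} {c : Fin n → Finset (Fin n)}

theorem graphOf_adj (c : Fin n → Finset (Fin n)) (u w : Fin n) :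
    (graphOf c).Adj u w ↔ u ≠ w ∧ (w ∈ c u ∨ u ∈ c w) := by
  rw [graphOf, SimpleGraph.fromRel_adj]

theorem picks_coe {A : Finset (Fin n)} (hA : A ⊆ H) (C : Finset (Fin n))
    (c : Fin n → Finset (Fin n)) :
    picks A C (fun u : {u // u ∈ H} => c u) = ∑ u ∈ A, (c u ∩ C).card := by
  unfold picks
  rw [Finset.sum_coe_sort H (fun u => if u ∈ A then (c u ∩ C).card else 0), Finset.sum_ite_mem,
    Finset.inter_eq_right.2 hA]

theorem picks_le_card_interedges [DecidableRel (graphOf c).Adj] {A C : Finset (Fin n)}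
    (hA : A ⊆ H) (hAC : Disjoint A C) :
    picks A C (fun u : {u // u ∈ H} => c u) ≤ ((graphOf c).interedges A C).card := by
  rw [picks_coe hA, SimpleGraph.interedges, Rel.interedges, Finset.card_filter,
    Finset.sum_product]
  refine Finset.sum_le_sum fun u hu => ?_
  rw [← Finset.card_filter]
  refine Finset.card_le_card fun w hw => ?_
  obtain ⟨hwc, hwC⟩ := Finset.mem_inter.1 hw
  exact Finset.mem_filter.2 ⟨hwC, (graphOf_adj c u w).2
    ⟨Finset.disjoint_left.1 hAC hu |>.imp (· ▸ hwC), Or.inl hwc⟩⟩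

theorem PicksExpand.expands (h : PicksExpand L fun u : {u // u ∈ H} => c u) :
    Expands H (graphOf c) (L / 8) := by
  classical
  intro A Q hAQ
  have hpicks : L / 8 * A.card * (H.card - Q.card) / H.card ≤
      picks A (H \ Q) fun u : {u // u ∈ H} => c u :=
    calc L / 8 * A.card * (H.card - Q.card) / H.card
        = L * A.card * (H.card - Q.card) / H.card / 8 := by ring
      _ ≤ _ := not_lt.1 fun hlt => h A Q ⟨hAQ, hlt⟩
  refine hpicks.trans (Nat.cast_le.2 ?_)
  convert picks_le_card_interedges (hAQ.subset.trans hAQ.subset_honest)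
    (Finset.disjoint_sdiff.mono_left hAQ.subset)

theorem honestDegree_le_card_honestNeighborFinset (c : Fin n → Finset (Fin n))
    (v : {u // u ∈ H}) :
    honestDegree v (fun u : {u // u ∈ H} => c u) ≤ (honestNeighborFinset H (graphOf c) v).card := by
  classical
  refine Finset.card_le_card_of_injOn Subtype.val (fun w hw => ?_) Subtype.val_injective.injOn
  obtain ⟨hwv, hw⟩ := Finset.mem_filter.1 hw
  rw [honestNeighborFinset, Finset.coe_filter]
  exact ⟨w.2, (graphOf_adj c v w).2
    ⟨fun h => (Finset.mem_erase.1 hwv).1 (Subtype.ext h.symm), hw⟩⟩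

end Graph

section Good

variable {n k : ℕ} {H : Finset (Fin n)} {L δ : ℝ}

/-- The selections from which a cheap flow out of `v` can be built: `v` has not many fewer honest
neighbours than the `L` honest users it selects on average, and the honest users expand. -/
def GoodSelections (L : ℝ) (v : {u // u ∈ H}) (c : {u // u ∈ H} → Finset (Fin n)) : Prop :=
  0.78 * L ≤ honestDegree v c ∧ PicksExpand L c

theorem exists_isHonestFlow_of_goodSelections (hH : 81 ≤ H.card)
    (hLm : 6 * Real.log (H.card / 3) ≤ L) {c : Fin n → Finset (Fin n)} {v : {u // u ∈ H}}
    (hc : GoodSelections L v fun u => c u) :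
    ∃ y, IsHonestFlow H (graphOf c) v y ∧
      ∑ e, y e ^ 2 ≤ 3 / (L - 3) + (12 + 6 * Real.log H.card) / H.card := by
  obtain ⟨hdeg, hexp⟩ := hc
  have hL := le_of_six_mul_log_le (by exact_mod_cast hH) hLm
  have hJ : L / 4 ≤ ⌈L / 4⌉₊ := Nat.le_ceil _
  have hJ' : (⌈L / 4⌉₊ : ℝ) < L / 4 + 1 := Nat.ceil_lt_add_one (by linarith)
  have hJ2 : 2 ≤ ⌈L / 4⌉₊ := by
    have : (2 : ℝ) ≤ ⌈L / 4⌉₊ := by linarith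
    exact_mod_cast this
  have hdegree : 0.78 * L ≤ (honestNeighborFinset H (graphOf c) v).card :=
    hdeg.trans (Nat.cast_le.2 (honestDegree_le_card_honestNeighborFinset c v))
  have hR : (0 : ℝ) ≤ 1 / (0.78 * L + 1 - ⌈L / 4⌉₊) := div_nonneg zero_le_one (by linarith)
  obtain ⟨y, hy, hyR⟩ := exists_isHonestFlow (by positivity)
    (hexp.expands.sq_sub_mean_le (by linarith) v.2 hJ2 (by linarith) hdegree)
  exact ⟨y, hy, hyR.trans (energy_bound_le hH hLm hJ hJ')⟩

theorem exp_sub_div_four_le {m : ℝ} (hm : 81 ≤ m) (hδ : 0 < δ)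
    (hL : 4 * Real.log (2 * m / (3 * δ)) ≤ L) : Real.exp (1.51 - L / 4) ≤ 0.2 * δ := by
  have hexp : Real.exp 1.51 ≤ 2.72 ^ 2 := by
    calc Real.exp 1.51 ≤ Real.exp ((2 : ℕ) * 1) := Real.exp_le_exp.2 (by norm_num)
      _ = Real.exp 1 ^ 2 := Real.exp_nat_mul _ _
      _ ≤ 2.72 ^ 2 :=
          pow_le_pow_left₀ (Real.exp_pos _).le (by linarith [Real.exp_one_lt_d9]) 2
  calc Real.exp (1.51 - L / 4)
      ≤ Real.exp (1.51 + -Real.log (2 * m / (3 * δ))) := Real.exp_le_exp.2 (by linarith)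
    _ = Real.exp 1.51 * (3 * δ / (2 * m)) := by
        rw [Real.exp_add, ← Real.log_inv, Real.exp_log (by positivity), inv_div]
    _ ≤ 2.72 ^ 2 * (3 * δ / (2 * 81)) := by gcongr
    _ ≤ 0.2 * δ := by linarith

open Classical in
theorem card_not_goodSelections_le (hk : k < n) (hH : 81 ≤ H.card)
    (hL : L = (k : ℝ) / n * H.card) (hδ : 0 < δ)
    (hLδ : 4 * Real.log (2 * H.card / (3 * δ)) ≤ L) (hLm : 6 * Real.log (H.card / 3) ≤ L)
    (v : {u // u ∈ H}) :
    (((honestSelections H k).filter fun c => ¬ GoodSelections L v c).card : ℝ) ≤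
      (honestSelections H k).card * (1.2 * δ) := by
  set F := honestSelections H k
  have hunion : (F.filter fun c => ¬ GoodSelections L v c) =
      (F.filter fun c => (honestDegree v c : ℝ) < 0.78 * L) ∪
        F.filter fun c => ¬ PicksExpand L c := by
    rw [← Finset.filter_or]
    exact Finset.filter_congr fun c _ => by rw [GoodSelections, not_and_or, not_le]
  calc ((F.filter fun c => ¬ GoodSelections L v c).card : ℝ)
      ≤ (F.filter fun c => (honestDegree v c : ℝ) < 0.78 * L).card +
          (F.filter fun c => ¬ PicksExpand L c).card := by
        rw [hunion]
        exact_mod_cast Finset.card_union_le _ _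
    _ ≤ F.card * Real.exp (1.51 - L / 4) + F.card * δ :=
        add_le_add (card_honestDegree_lt_le hk v hL) (card_not_picksExpand_le hk hH hL hδ hLδ hLm)
    _ ≤ F.card * (0.2 * δ) + F.card * δ := by
        gcongr
        exact exp_sub_div_four_le (by exact_mod_cast hH) hδ hLδ
    _ = F.card * (1.2 * δ) := by ring

end Good

section Mixture

theorem tsum_mul_le_add_toOuterMeasure {α : Type*} (p : PMF α) (B : Set α)
    {g g' : α → ℝ≥0∞} {K τ : ℝ≥0∞} (hg : ∀ c, g c ≤ 1) (hgood : ∀ c ∉ B, g c ≤ K * g' c + τ) :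
    ∑' c, p c * g c ≤ K * ∑' c, p c * g' c + (τ + p.toOuterMeasure B) := by
  have hterm : ∀ c, p c * g c ≤ K * (p c * g' c) + (p c * τ + B.indicator p c) := fun c => by
    by_cases hc : c ∈ B
    · rw [Set.indicator_of_mem hc, ← add_assoc]
      exact (mul_le_of_le_one_right' (hg c)).trans le_add_self
    · rw [Set.indicator_of_notMem hc, add_zero]
      calc p c * g c ≤ p c * (K * g' c + τ) := mul_le_mul_right (hgood c hc) _
        _ = _ := by ring
  calc ∑' c, p c * g c ≤ ∑' c, (K * (p c * g' c) + (p c * τ + B.indicator p c)) :=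
        ENNReal.tsum_le_tsum hterm
    _ = _ := by
        rw [ENNReal.tsum_add, ENNReal.tsum_add, ENNReal.tsum_mul_left, ENNReal.tsum_mul_right,
          PMF.tsum_coe, one_mul, PMF.toOuterMeasure_apply]

variable {n k : ℕ} {H : Finset (Fin n)}

theorem selectionLaw_map_restrict (hk : k < n) (adv : Strategy H) :
    (selectionLaw H k hk adv).map (fun c (u : {u // u ∈ H}) => c u.1) =
      PMF.uniformOfFinset (honestSelections H k) (honestSelections_nonempty H hk) := by
  unfold selectionLaw
  rw [PMF.map_bind]
  simp_rw [PMF.map_comp]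
  refine (congrArg _ (funext fun c => ?_)).trans (PMF.bind_pure _)
  rw [← PMF.map_const (adv c) c]
  congr 1
  funext d u
  simp

theorem toOuterMeasure_selectionLaw_le (hk : k < n) (adv : Strategy H)
    (bad : ({u // u ∈ H} → Finset (Fin n)) → Prop) [DecidablePred bad] {β : ℝ}
    (hβ : (((honestSelections H k).filter bad).card : ℝ) ≤ (honestSelections H k).card * β) :
    (selectionLaw H k hk adv).toOuterMeasure {c | bad fun u => c u} ≤ ENNReal.ofReal β := by
  have hpos : (0 : ℝ) < (honestSelections H k).card := by
    exact_mod_cast (honestSelections_nonempty H hk).card_pos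
  calc (selectionLaw H k hk adv).toOuterMeasure {c | bad fun u => c u}
      = ((selectionLaw H k hk adv).map fun c (u : {u // u ∈ H}) => c u.1).toOuterMeasure
          {c | bad c} := (PMF.toOuterMeasure_map_apply _ _ _).symm
    _ = ((honestSelections H k).filter bad).card / (honestSelections H k).card := by
        rw [selectionLaw_map_restrict, PMF.toOuterMeasure_uniformOfFinset_apply]
        congr!
    _ = ENNReal.ofReal
          (((honestSelections H k).filter bad).card / (honestSelections H k).card) := by
        rw [ENNReal.ofReal_div_of_pos hpos, ENNReal.ofReal_natCast, ENNReal.ofReal_natCast]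
    _ ≤ ENNReal.ofReal β := ENNReal.ofReal_le_ofReal ((div_le_iff₀' hpos).2 hβ)

theorem gopaKOut_apply (hk : k < n) (adv : Strategy H) (ση σΔ : ℝ≥0) (X : Dataset n)
    {O : Set (View H)} (hO : MeasurableSet O) :
    gopaKOut H k hk adv ση σΔ X O =
      ∑' c, selectionLaw H k hk adv c * gopaOn H ση σΔ (graphOf c) X O := by
  simp only [gopaKOut, Measure.sum_apply _ hO, Measure.smul_apply, smul_eq_mul]

theorem gopaOn_apply_le_one (H : Finset (Fin n)) (ση σΔ : ℝ≥0) (G : SimpleGraph (Fin n))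
    (X : Dataset n) (O : Set (View H)) : gopaOn H ση σΔ G X O ≤ 1 := by
  have : IsProbabilityMeasure (gopaOn H ση σΔ G X) :=
    Measure.isProbabilityMeasure_map (measurable_view H G X).aemeasurable
  exact prob_le_one

end Mixture

section Calibration

variable {ε δ θ : ℝ}

theorem exp_neg_le_of_calibration (hδ : 0 < δ) (hθ : 0 < θ)
    (h : 2 * Real.log (2 / (δ * Real.sqrt (2 * Real.pi))) * θ ≤ (ε - θ / 2) ^ 2) :
    Real.exp (-((ε - θ / 2) ^ 2 / (2 * θ))) ≤ 1.3 * δ := by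
  have hsqrt : Real.sqrt (2 * Real.pi) ≤ 2.6 :=
    Real.sqrt_le_left (by norm_num) |>.2 (by linarith [Real.pi_lt_d2])
  have hexponent : Real.log (2 / (δ * Real.sqrt (2 * Real.pi))) ≤ (ε - θ / 2) ^ 2 / (2 * θ) := by
    rw [le_div_iff₀ (by positivity)]
    linarith
  calc Real.exp (-((ε - θ / 2) ^ 2 / (2 * θ)))
      ≤ Real.exp (-Real.log (2 / (δ * Real.sqrt (2 * Real.pi)))) :=
        Real.exp_le_exp.2 (neg_le_neg hexponent)
    _ = δ * Real.sqrt (2 * Real.pi) / 2 := by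
        rw [← Real.log_inv, Real.exp_log (by positivity), inv_div]
    _ ≤ δ * 2.6 / 2 := by gcongr
    _ = 1.3 * δ := by ring

theorem three_div_le_one_div_floor {ρ x : ℝ} (hρ : 0 ≤ ρ) (hρ' : ρ ≤ 1) (hx : 7 ≤ ρ * x) :
    3 / (ρ * x - 3) ≤ 1 / ((⌊(x - 1) * ρ / 3⌋ : ℝ) - 1) := by
  have hfloor := Int.floor_le ((x - 1) * ρ / 3)
  have hfloor' := Int.lt_floor_add_one ((x - 1) * ρ / 3)
  rw [div_le_div_iff₀ (by linarith) (by linarith)]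
  linarith

end Calibration

variable {n k : ℕ} {H : Finset (Fin n)} {L ε δ θ : ℝ} {ση σΔ : ℝ≥0}

theorem gopaOn_le_of_goodSelections (hH : 81 ≤ H.card) (hLm : 6 * Real.log (H.card / 3) ≤ L)
    (hδ : 0 < δ) (hση : 0 < ση) (hσΔ : 0 < σΔ)
    (hθ : 1 / ((H.card : ℝ) * (ση : ℝ) ^ 2) +
      (3 / (L - 3) + (12 + 6 * Real.log H.card) / H.card) / (σΔ : ℝ) ^ 2 ≤ θ)
    (hε : θ / 2 ≤ ε)
    (hcal : 2 * Real.log (2 / (δ * Real.sqrt (2 * Real.pi))) * θ ≤ (ε - θ / 2) ^ 2)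
    {c : Fin n → Finset (Fin n)} {v : {u // u ∈ H}} (hc : GoodSelections L v fun u => c u)
    {X X' : Dataset n} (hX : ∀ u, u ≠ v.1 → X u = X' u) {O : Set (View H)} (hO : MeasurableSet O) :
    gopaOn H ση σΔ (graphOf c) X O ≤ ENNReal.ofReal (Real.exp ε) *
      gopaOn H ση σΔ (graphOf c) X' O + ENNReal.ofReal (1.3 * δ) := by
  obtain ⟨y, hy, hyR⟩ := exists_isHonestFlow_of_goodSelections hH hLm hc
  have hyθ : 1 / ((H.card : ℝ) * (ση : ℝ) ^ 2) + (∑ e, y e ^ 2) / (σΔ : ℝ) ^ 2 ≤ θ :=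
    le_trans (by gcongr) hθ
  have hθ0 : 0 < θ := by
    have : (0 : ℝ) < H.card := by exact_mod_cast (by omega : 0 < H.card)
    have : (0 : ℝ) < ση := hση
    exact lt_of_lt_of_le (by positivity) hyθ
  refine (gopaOn_le_of_honestFlow v.2 hy hX hση hσΔ hyθ hε hO).trans ?_
  gcongr
  exact exp_neg_le_of_calibration hδ hθ0 hcal

theorem isDP_gopaKOut (hk : k < n) (hH : 81 ≤ H.card) (hL : L = (k : ℝ) / n * H.card)
    (hδ : 0 < δ) (hση : 0 < ση) (hσΔ : 0 < σΔ)
    (hLδ : 4 * Real.log (2 * H.card / (3 * δ)) ≤ L) (hLm : 6 * Real.log (H.card / 3) ≤ L)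
    (hθ : 1 / ((H.card : ℝ) * (ση : ℝ) ^ 2) +
      (3 / (L - 3) + (12 + 6 * Real.log H.card) / H.card) / (σΔ : ℝ) ^ 2 ≤ θ)
    (hε : θ / 2 ≤ ε)
    (hcal : 2 * Real.log (2 / (δ * Real.sqrt (2 * Real.pi))) * θ ≤ (ε - θ / 2) ^ 2)
    (adv : Strategy H) :
    IsDP (HonestNeighbors H) (gopaKOut H k hk adv ση σΔ) ε (3 * δ) := by
  classical
  rintro X X' ⟨v, hv, hX⟩ O hO
  have hbad := toOuterMeasure_selectionLaw_le hk adv (fun c => ¬ GoodSelections L ⟨v, hv⟩ c)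
    (card_not_goodSelections_le hk hH hL hδ hLδ hLm ⟨v, hv⟩)
  rw [gopaKOut_apply hk adv ση σΔ X hO, gopaKOut_apply hk adv ση σΔ X' hO]
  refine (tsum_mul_le_add_toOuterMeasure (selectionLaw H k hk adv)
    {c | ¬ GoodSelections L ⟨v, hv⟩ fun u => c u} (fun c => gopaOn_apply_le_one ..)
    fun c hc => gopaOn_le_of_goodSelections hH hLm hδ hση hσΔ hθ hε hcal (not_not.1 hc) hX hO).trans
      ?_
  gcongr
  calc ENNReal.ofReal (1.3 * δ) + (selectionLaw H k hk adv).toOuterMeasure _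
      ≤ ENNReal.ofReal (1.3 * δ) + ENNReal.ofReal (1.2 * δ) := by gcongr
    _ = ENNReal.ofReal (2.5 * δ) := by
        rw [← ENNReal.ofReal_add (by positivity) (by positivity)]
        ring_nf
    _ ≤ ENNReal.ofReal (3 * δ) := ENNReal.ofReal_le_ofReal (by linarith)

end Gopa

theorem theorem3_general (n k : ℕ) (hk : k < n) (H : Finset (Fin n)) (ρ : ℝ)
    (hρ : ρ = (H.card : ℝ) / (n : ℝ)) (ε δ : ℝ) (hδ : 0 < δ)
    (ση σΔ : ℝ≥0) (hση : 0 < ση) (hσΔ : 0 < σΔ)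
    (hn : 81 ≤ ρ * n)
    (hk1 : 4 * Real.log (2 * (ρ * n) / (3 * δ)) ≤ ρ * k)
    (hk2 : 6 * Real.log (ρ * n / 3) ≤ ρ * k)
    (θ : ℝ)
    (hθ : θ = 1 / ((H.card : ℝ) * (ση : ℝ) ^ 2) +
      (1 / ((⌊((k : ℝ) - 1) * ρ / 3⌋ : ℝ) - 1) +
        (12 + 6 * Real.log (H.card : ℝ)) / (H.card : ℝ)) / (σΔ : ℝ) ^ 2)
    (h1 : θ / 2 ≤ ε)
    (h2 : 2 * Real.log (2 / (δ * Real.sqrt (2 * Real.pi))) * θ ≤ (ε - θ / 2) ^ 2)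
    (adv : Gopa.Strategy H) :
    Gopa.IsDP (Gopa.HonestNeighbors H) (Gopa.gopaKOut H k hk adv ση σΔ) ε (3 * δ) := by
  have hn0 : (0 : ℝ) < n := by exact_mod_cast Nat.zero_lt_of_lt hk
  have hρn : ρ * n = H.card := by rw [hρ, div_mul_cancel₀ _ hn0.ne']
  have hρ0 : 0 ≤ ρ := by rw [hρ]; positivity
  have hρ1 : ρ ≤ 1 := by
    rw [hρ, div_le_one hn0]
    exact_mod_cast card_finset_fin_le H
  have hL : ρ * k = (k : ℝ) / n * H.card := by rw [hρ]; ring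
  rw [hρn] at hn hk1 hk2
  have hLbound := Gopa.le_of_six_mul_log_le hn hk2
  refine Gopa.isDP_gopaKOut hk (by exact_mod_cast hn) hL hδ hση hσΔ hk1 hk2 ?_ h1 h2 adv
  have hfloor := Gopa.three_div_le_one_div_floor hρ0 hρ1 (x := k) (by linarith)
  rw [hθ]
  gcongr

theorem theorem3 (n k : ℕ) (hk : k < n) (H : Finset (Fin n)) (ρ : ℝ)
    (hρ : ρ = (H.card : ℝ) / (n : ℝ))
    (ε δ : ℝ) (hε : 0 < ε) (hε1 : ε < 1) (hδ : 0 < δ) (hδ1 : δ < 1)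
    (ση σΔ : ℝ≥0) (hση : 0 < ση) (hσΔ : 0 < σΔ)
    (hn : 81 ≤ ρ * n)
    (hk1 : 4 * Real.log (2 * (ρ * n) / (3 * δ)) ≤ ρ * k)
    (hk2 : 6 * Real.log (ρ * n / 3) ≤ ρ * k)
    (hk3 : 3 / 2 + 9 / 4 * Real.log (2 * Real.exp 1 / δ) ≤ ρ * k)
    (θ : ℝ)
    (hθ : θ = 1 / ((H.card : ℝ) * (ση : ℝ) ^ 2) +
      (1 / ((⌊((k : ℝ) - 1) * ρ / 3⌋ : ℝ) - 1) +
        (12 + 6 * Real.log (H.card : ℝ)) / (H.card : ℝ)) / (σΔ : ℝ) ^ 2)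
    (h1 : θ / 2 + Real.sqrt θ ≤ ε)
    (h2 : 2 * Real.log (2 / (δ * Real.sqrt (2 * Real.pi))) * θ ≤ (ε - θ / 2) ^ 2)
    (adv : Gopa.Strategy H) :
    Gopa.IsDP (Gopa.HonestNeighbors H) (Gopa.gopaKOut H k hk adv ση σΔ) ε (3 * δ) :=
  theorem3_general n k hk H ρ hρ ε δ hδ ση σΔ hση hσΔ hn hk1 hk2 θ hθ
    (by linarith [Real.sqrt_nonneg θ]) h2 adv
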